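/- All polytopes are $3$-dimensional simplicial convex polytopes; "face" means $2$-dimensional face (a triangle), the degree of a vertex is its degree in the $1$-skeleton, and isomorphism means combinatorial isomorphism (a bijection between the vertex sets under which the boundary complexes correspond). A \emph{connected sum} of polytopes $P$ and $Q$ is a polytope whose boundary complex is obtained from the boundary complexes of $P$ and $Q$ by choosing a face of $P$ and a face of $Q$, identifying their vertices by some bijection, and deleting the common face. Let $\mathcal{C}(P\#Q)$ be the set of connected sums of $P$ and $Q$ up to isomorphism. A polytope is \emph{irreducible} if it is not a connected sum of two polytopes. The \emph{type} of a face is the triple $(x,y,z)$ of the degrees of its three vertices, with $x\ge y\ge z$. A polytope is \emph{face-transitive} if all its faces have the same type, and \emph{regular} if moreover this common type is $(x,x,x)$ for some integer $x$. \textbf{Lemma.} Let $P$ and $Q$ be irreducible polytopes with $|\mathcal{C}(P\#Q)|=1$. Then one of $P$, $Q$ is regular and the other is face-transitive. -/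

import Mathlib

/-- A `3`-dimensional simplicial polytope: the convex hull of a finite subset of `ℝ³`, with
non-empty interior, all of whose proper faces are simplices (the vertices of each proper face are
affinely independent). The faces of a polytope are its exposed subsets. -/
structure SimplicialPolytope where
  carrier : Set (EuclideanSpace ℝ (Fin 3))
  exists_finset : ∃ s : Finset (EuclideanSpace ℝ (Fin 3)),
    carrier = convexHull ℝ (s : Set (EuclideanSpace ℝ (Fin 3)))
  interior_nonempty : (interior carrier).Nonempty
  simplicial : ∀ A : Set (EuclideanSpace ℝ (Fin 3)), IsExposed ℝ carrier A → A ≠ carrier →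
    AffineIndependent ℝ
      (Subtype.val : Set.extremePoints ℝ A → EuclideanSpace ℝ (Fin 3))

namespace SimplicialPolytope

/-- The type of vertices of `P`. -/
abbrev Vertex (P : SimplicialPolytope) : Type := Set.extremePoints ℝ P.carrier

/-- The boundary complex of `P`: `σ` is the vertex set of a proper (possibly empty) face of `P`. -/
def IsFace (P : SimplicialPolytope) (σ : Set P.Vertex) : Prop :=
  IsExposed ℝ P.carrier (convexHull ℝ (Subtype.val '' σ)) ∧
    convexHull ℝ (Subtype.val '' σ) ≠ P.carrier

/-- `σ` is the vertex set of a facet (a `2`-dimensional face). Since proper faces are simplices,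
these are the proper faces with exactly three vertices. -/
def IsFacet (P : SimplicialPolytope) (σ : Set P.Vertex) : Prop :=
  P.IsFace σ ∧ σ.ncard = 3

/-- The `1`-skeleton of `P`. -/
def graph (P : SimplicialPolytope) : SimpleGraph P.Vertex where
  Adj v w := v ≠ w ∧ P.IsFace {v, w}
  symm := ⟨fun _ _ h => ⟨h.1.symm, Set.pair_comm _ _ ▸ h.2⟩⟩
  loopless := ⟨fun _ h => h.1 rfl⟩

/-- The degree of a vertex: the number of its neighbours in the `1`-skeleton. -/
noncomputable def degree (P : SimplicialPolytope) (v : P.Vertex) : ℕ :=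
  (P.graph.neighborSet v).ncard

/-- The facet with vertex set `F` has type `(x, y, z)`: its three vertices have degrees
`x ≥ y ≥ z`. -/
def FacetHasType (P : SimplicialPolytope) (F : Set P.Vertex) (x y z : ℕ) : Prop :=
  x ≥ y ∧ y ≥ z ∧ ∃ u v w : P.Vertex, u ≠ v ∧ u ≠ w ∧ v ≠ w ∧ F = {u, v, w} ∧
    P.degree u = x ∧ P.degree v = y ∧ P.degree w = z

/-- `P` has type `(x, y, z)`: all facets of `P` have type `(x, y, z)`. -/
def HasType (P : SimplicialPolytope) (x y z : ℕ) : Prop :=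
  ∀ F : Set P.Vertex, P.IsFacet F → P.FacetHasType F x y z

/-- All facets of `P` have the same type. -/
def FaceTransitive (P : SimplicialPolytope) : Prop :=
  ∃ x y z : ℕ, P.HasType x y z

/-- `P` is face-transitive of type `(x, x, x)` for some `x`. -/
def Regular (P : SimplicialPolytope) : Prop :=
  ∃ x : ℕ, P.HasType x x x

/-- Combinatorial isomorphism: a bijection of the vertices which preserves and reflects faces. -/
def Isomorphic (P Q : SimplicialPolytope) : Prop :=
  ∃ e : P.Vertex ≃ Q.Vertex, ∀ σ : Set P.Vertex, P.IsFace σ ↔ Q.IsFace (e '' σ)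

theorem Isomorphic.equivalence : Equivalence Isomorphic where
  refl P := ⟨Equiv.refl _, fun σ => by simp⟩
  symm := by
    rintro P Q ⟨e, he⟩
    refine ⟨e.symm, fun σ => ?_⟩
    rw [he, Equiv.image_symm_image]
  trans := by
    rintro P Q R ⟨e, he⟩ ⟨f, hf⟩
    refine ⟨e.trans f, fun σ => ?_⟩
    rw [he, hf, Equiv.coe_trans, Set.image_comp]

/-- Polytopes up to isomorphism. -/
def isoSetoid : Setoid SimplicialPolytope := ⟨Isomorphic, Isomorphic.equivalence⟩

/-- The polytope `R` is a connected sum of `P` and `Q`: its boundary complex is obtained from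
those of `P` and `Q` by choosing a facet `F` of `P` and a facet `G` of `Q`, identifying the
vertices of `F` with those of `G` by some bijection, and removing the facet `F = G`.
Here `i` and `j` are the inclusions of the vertices of `P` and of `Q` into the glued vertex set. -/
def IsConnectedSum (P Q R : SimplicialPolytope) : Prop :=
  ∃ (F : Set P.Vertex) (G : Set Q.Vertex) (i : P.Vertex ↪ R.Vertex) (j : Q.Vertex ↪ R.Vertex),
    P.IsFacet F ∧ Q.IsFacet G ∧
    i '' F = j '' G ∧
    Set.range i ∩ Set.range j = i '' F ∧
    Set.range i ∪ Set.range j = Set.univ ∧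
    ∀ τ : Set R.Vertex, R.IsFace τ ↔
      (∃ σ : Set P.Vertex, P.IsFace σ ∧ σ ≠ F ∧ i '' σ = τ) ∨
      (∃ σ : Set Q.Vertex, Q.IsFace σ ∧ σ ≠ G ∧ j '' σ = τ)

/-- The set of connected sums of `P` and `Q`, up to isomorphism. -/
def connectedSums (P Q : SimplicialPolytope) : Set (Quotient isoSetoid) :=
  {c | ∃ R : SimplicialPolytope, IsConnectedSum P Q R ∧ Quotient.mk isoSetoid R = c}

/-- `P` is not a connected sum of two polytopes. -/
def Irreducible (P : SimplicialPolytope) : Prop :=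
  ¬ ∃ P₁ P₂ : SimplicialPolytope, IsConnectedSum P₁ P₂ P

end SimplicialPolytope

/-!
In homogeneous coordinates, the boundary complex of a polytope is that of a finite configuration of
vectors in `ℝ⁴`. Coordinates can be chosen such that three given vertices are the first three basis
vectors, the other vectors lie off the hyperplane spanned by these and their first three coordinates
are positive: for the vertices of a facet all of them then lie on one side of the hyperplane, for
three pairwise adjacent vertices which do not form a facet (a missing triangle) there are some on
either side. In such coordinates, taking the union of two configurations on opposite sides amounts
to gluing polytopes. Hence polytopes can be glued along any two facets by any bijection of their
vertices, and irreducible polytopes have no missing triangles.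

In a connected sum of irreducible polytopes, the common triangle is therefore the only missing
triangle, so isomorphisms preserve it. If its vertices have degrees `pₖ` in `P` and `qₖ` in `Q`,
their degrees in the sum are `pₖ + qₖ - 2`. When there is only one connected sum, the multiset of
the `pₖ + q_σ(k)` does not depend on the facets and the permutation `σ`. Comparing sums of squares,
`∑ pₖ q_σ(k)` does not depend on `σ`, which means `(pₖ - pₗ) (qₘ - qₙ) = 0` for all `k`, `l`, `m`
and `n`. So the degrees are constant on each facet of one of the polytopes; varying its facet and
then that of the other shows that the former is regular and the latter face-transitive.
-/

section ConeFaces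

variable {V W : Type*} [AddCommGroup V] [Module ℝ V] [AddCommGroup W] [Module ℝ W]
  {S S' F G : Set V}

/-- `F` consists of the vectors of the configuration `S` which lie on a proper face of the convex
cone generated by `S`: some linear functional vanishes on `F` and is positive on the rest of `S`,
which is nonempty. Faces are recorded by the vectors they contain, not as subsets of the cone. -/
def IsConeFace (S F : Set V) : Prop :=
  F ⊂ S ∧ ∃ ℓ : Module.Dual ℝ V, (∀ v ∈ F, ℓ v = 0) ∧ ∀ v ∈ S \ F, 0 < ℓ v

/-- `S` is a simplicial configuration: a finite set of vectors generating a full-dimensional pointed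
cone, on pairwise distinct extreme rays of it, such that all proper faces of the cone are
simplicial. These are the vertex sets of simplicial polytopes in homogeneous coordinates. -/
structure IsSimplicialConfig (S : Set V) : Prop where
  finite : S.Finite
  span_eq_top : Submodule.span ℝ S = ⊤
  empty : IsConeFace S ∅
  singleton : ∀ v ∈ S, IsConeFace S {v}
  linearIndepOn : ∀ F, IsConeFace S F → LinearIndepOn ℝ id F

theorem IsConeFace.restrict (hF : IsConeFace S F) (hS : S' ⊆ S) (hFS : F ⊂ S') :
    IsConeFace S' F := by
  obtain ⟨-, ℓ, hzero, hpos⟩ := hF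
  exact ⟨hFS, ℓ, hzero, fun v hv => hpos v ⟨hS hv.1, hv.2⟩⟩

theorem exists_dual_eq_of_linearIndependent {ι K U : Type*} [Field K] [AddCommGroup U] [Module K U]
    {p : ι → U} (hp : LinearIndependent K p) (g : ι → K) :
    ∃ m : Module.Dual K U, ∀ i, m (p i) = g i := by
  obtain ⟨m, hm⟩ := LinearMap.exists_extend ((Module.Basis.span hp).constr K g)
  refine ⟨m, fun i => ?_⟩
  have := LinearMap.congr_fun hm (Module.Basis.span hp i)
  rwa [Module.Basis.constr_basis, LinearMap.comp_apply, Submodule.subtype_apply,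
    Module.Basis.span_apply] at this

theorem exists_forall_pos_add_mul {α : Type*} {s : Set α} (hs : s.Finite) (f g : α → ℝ)
    (hg : ∀ x ∈ s, 0 < g x) : ∃ N : ℝ, ∀ x ∈ s, 0 < f x + N * g x := by
  obtain ⟨N, hN⟩ := (hs.image fun x => (1 - f x) / g x).bddAbove
  refine ⟨N, fun x hx => ?_⟩
  have := (div_le_iff₀ (hg x hx)).1 (hN ⟨x, hx, rfl⟩)
  linarith

theorem IsSimplicialConfig.isConeFace_mono (hS : IsSimplicialConfig S) (hF : IsConeFace S F)
    (hGF : G ⊆ F) : IsConeFace S G := by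
  classical
  obtain ⟨m, hm⟩ := exists_dual_eq_of_linearIndependent (hS.linearIndepOn F hF)
    fun v => if (v : V) ∈ G then 0 else 1
  obtain ⟨hFS, ℓ, hzero, hpos⟩ := hF
  obtain ⟨N, hN⟩ := exists_forall_pos_add_mul (hS.finite.sdiff) m ℓ hpos
  have eq_of_mem : ∀ v ∈ F, (m + N • ℓ) v = if v ∈ G then 0 else 1 := fun v hv => by
    simp [show m v = _ from hm ⟨v, hv⟩, hzero v hv]
  refine ⟨hGF.trans_ssubset hFS, m + N • ℓ, fun v hv => ?_, fun v hv => ?_⟩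
  · rw [eq_of_mem v (hGF hv), if_pos hv]
  · by_cases hvF : v ∈ F
    · rw [eq_of_mem v hvF, if_neg hv.2]
      exact one_pos
    · exact hN v ⟨hv.1, hvF⟩

theorem isConeFace_image_equiv_iff (A : V ≃ₗ[ℝ] W) :
    IsConeFace (A '' S) (A '' F) ↔ IsConeFace S F := by
  refine and_congr (A.injective.injOn.image_ssubset_image_iff F.subset_univ S.subset_univ) ⟨?_, ?_⟩
  · rintro ⟨ℓ, hzero, hpos⟩
    refine ⟨ℓ ∘ₗ A, fun v hv => hzero _ ⟨v, hv, rfl⟩, fun v hv => hpos _ ?_⟩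
    rw [← Set.image_sdiff A.injective]
    exact ⟨v, hv, rfl⟩
  · rintro ⟨ℓ, hzero, hpos⟩
    rw [← Set.image_sdiff A.injective]
    refine ⟨ℓ ∘ₗ A.symm, ?_, ?_⟩
    · rintro _ ⟨v, hv, rfl⟩
      simpa using hzero v hv
    · rintro _ ⟨v, hv, rfl⟩
      simpa using hpos v hv

theorem IsSimplicialConfig.image_equiv (hS : IsSimplicialConfig S) (A : V ≃ₗ[ℝ] W) :
    IsSimplicialConfig (A '' S) where
  finite := hS.finite.image A
  span_eq_top := by
    rw [← LinearEquiv.coe_coe, Submodule.span_image, hS.span_eq_top, Submodule.map_top,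
      LinearEquiv.range]
  empty := by simpa using (isConeFace_image_equiv_iff A).2 hS.empty
  singleton := by
    rintro _ ⟨v, hv, rfl⟩
    simpa using (isConeFace_image_equiv_iff A).2 (hS.singleton v hv)
  linearIndepOn F hF := by
    obtain ⟨G, -, rfl⟩ := Set.subset_image_iff.1 hF.1.subset
    exact ((hS.linearIndepOn G ((isConeFace_image_equiv_iff A).1 hF)).map_injOn A.toLinearMap
      A.injective.injOn).id_image

theorem IsSimplicialConfig.injOn_smul (hS : IsSimplicialConfig S) {c : V → ℝ}
    (hc : ∀ v ∈ S, 0 < c v) : S.InjOn fun v => c v • v := by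
  intro v hv w hw (hvw : c v • v = c w • w)
  by_contra hne
  obtain ⟨-, ℓ, hzero, hpos⟩ := hS.singleton v hv
  have hw' := hpos w ⟨hw, fun h => hne (Set.mem_singleton_iff.1 h).symm⟩
  have := congrArg ℓ hvw
  rw [map_smul, map_smul, hzero v rfl, smul_zero] at this
  exact (smul_pos (hc w hw) hw').ne this

theorem isConeFace_image_smul_iff {c : V → ℝ} (hc : ∀ v ∈ S, 0 < c v)
    (hinj : S.InjOn fun v => c v • v) (hF : F ⊆ S) :
    IsConeFace ((fun v => c v • v) '' S) ((fun v => c v • v) '' F) ↔ IsConeFace S F := by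
  rw [IsConeFace, hinj.image_ssubset_image_iff hF subset_rfl, ← hinj.image_sdiff_subset hF]
  refine and_congr_right fun _ => exists_congr fun ℓ => ?_
  simp only [Set.forall_mem_image, map_smul, smul_eq_mul]
  refine and_congr (forall₂_congr fun v hv => ?_) (forall₂_congr fun v hv => ?_)
  · rw [mul_eq_zero, or_iff_right (hc v (hF hv)).ne']
  · rw [mul_pos_iff_of_pos_left (hc v hv.1)]

theorem IsSimplicialConfig.image_smul (hS : IsSimplicialConfig S) {c : V → ℝ}
    (hc : ∀ v ∈ S, 0 < c v) : IsSimplicialConfig ((fun v => c v • v) '' S) where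
  finite := hS.finite.image _
  span_eq_top := by
    rw [← top_le_iff, ← hS.span_eq_top, Submodule.span_le]
    intro v hv
    rw [← inv_smul_smul₀ (hc v hv).ne' v]
    exact Submodule.smul_mem _ _ (Submodule.subset_span ⟨v, hv, rfl⟩)
  empty := by
    simpa using (isConeFace_image_smul_iff hc (hS.injOn_smul hc) (Set.empty_subset S)).2
      hS.empty
  singleton := by
    rintro _ ⟨v, hv, rfl⟩
    simpa using (isConeFace_image_smul_iff hc (hS.injOn_smul hc) (Set.singleton_subset_iff.2 hv)).2
      (hS.singleton v hv)
  linearIndepOn F hF := by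
    obtain ⟨G, hGS, rfl⟩ := Set.subset_image_iff.1 hF.1.subset
    have hG := hS.linearIndepOn G ((isConeFace_image_smul_iff hc (hS.injOn_smul hc) hGS).1 hF)
    exact LinearIndepOn.id_image
      (LinearIndependent.units_smul hG fun v => Units.mk0 (c v) (hc v (hGS v.2)).ne')

end ConeFaces

section Homogenization

open Set

variable {E : Type*} [AddCommGroup E] [Module ℝ E] {s F : Set E}

/-- The homogeneous coordinates `(x, 1)` of a point `x`. Affine functions of `x` become linear
functions of `homogenize x`. -/
def homogenize (x : E) : E × ℝ := (x, 1)

theorem homogenize_injective {E : Type*} : Function.Injective (homogenize : E → E × ℝ) :=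
  fun _ _ => congrArg Prod.fst

theorem homogenize_combo {a b : ℝ} (hab : a + b = 1) (x y : E) :
    homogenize (a • x + b • y) = a • homogenize x + b • homogenize y := by
  simp [homogenize, hab]

theorem linearIndependent_homogenize_iff {ι : Type*} (x : ι → E) :
    LinearIndependent ℝ (fun i => homogenize (x i)) ↔ AffineIndependent ℝ x := by
  rw [linearIndependent_iff', affineIndependent_iff]
  refine forall_congr' fun t => forall_congr' fun w => ?_
  have : ∑ i ∈ t, w i • homogenize (x i) = (∑ i ∈ t, w i • x i, ∑ i ∈ t, w i) := by
    ext <;> simp [homogenize, Prod.fst_sum, Prod.snd_sum]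
  rw [this, Prod.mk_eq_zero]
  tauto

theorem linearIndepOn_homogenize_image_iff :
    LinearIndepOn ℝ id (homogenize '' F) ↔ AffineIndependent ℝ ((↑) : F → E) := by
  rw [← linearIndepOn_iff_image homogenize_injective.injOn]
  exact linearIndependent_homogenize_iff _

theorem span_homogenize_eq_top_iff :
    Submodule.span ℝ (homogenize '' s) = ⊤ ↔ affineSpan ℝ s = ⊤ := by
  rcases s.eq_empty_or_nonempty with rfl | ⟨x₀, hx₀⟩
  · simp [bot_ne_top]
  rw [AffineSubspace.affineSpan_eq_top_iff_vectorSpan_eq_top_of_nonempty ℝ E E ⟨x₀, hx₀⟩]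
  constructor <;> intro h
  · let f : E × ℝ →ₗ[ℝ] E := LinearMap.fst ℝ E ℝ - (LinearMap.snd ℝ E ℝ).smulRight x₀
    have hle : Submodule.span ℝ (homogenize '' s) ≤ (vectorSpan ℝ s).comap f := by
      rw [Submodule.span_le]
      rintro _ ⟨x, hx, rfl⟩
      simpa [f, homogenize] using vsub_mem_vectorSpan ℝ hx hx₀
    rw [h] at hle
    exact eq_top_iff.2 fun x _ => by simpa [f] using hle (Submodule.mem_top (x := (x, (0 : ℝ))))
  · have hle : vectorSpan ℝ s ≤
        (Submodule.span ℝ (homogenize '' s)).comap (LinearMap.inl ℝ E ℝ) := by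
      rw [vectorSpan_def, Submodule.span_le]
      rintro _ ⟨x, hx, y, hy, rfl⟩
      simpa [homogenize] using Submodule.sub_mem _
        (Submodule.subset_span (mem_image_of_mem homogenize hx))
        (Submodule.subset_span (mem_image_of_mem homogenize hy))
    rw [h] at hle
    refine eq_top_iff.2 fun ⟨x, c⟩ _ => ?_
    have hx : (x - c • x₀, (0 : ℝ)) ∈ Submodule.span ℝ (homogenize '' s) :=
      hle (Submodule.mem_top (x := x - c • x₀))
    simpa [homogenize] using Submodule.add_mem _ hx
      (Submodule.smul_mem _ c (Submodule.subset_span (mem_image_of_mem homogenize hx₀)))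

theorem nonneg_of_mem_convexHull {ℓ : Module.Dual ℝ (E × ℝ)} (hℓ : ∀ x ∈ s, 0 ≤ ℓ (homogenize x))
    {x : E} (hx : x ∈ convexHull ℝ s) : 0 ≤ ℓ (homogenize x) := by
  refine convexHull_min (t := {x | 0 ≤ ℓ (homogenize x)}) hℓ ?_ hx
  intro x hx y hy a b ha hb hab
  simp only [mem_ofPred_eq, homogenize_combo hab, map_add, map_smul, smul_eq_mul] at hx hy ⊢
  positivity

theorem convexHull_inter_zeros {ℓ : Module.Dual ℝ (E × ℝ)} (hℓ : ∀ x ∈ s, 0 ≤ ℓ (homogenize x)) :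
    {x ∈ convexHull ℝ s | ℓ (homogenize x) = 0} =
      convexHull ℝ {x ∈ s | ℓ (homogenize x) = 0} := by
  refine Subset.antisymm ?_ (convexHull_min (fun x hx => ⟨subset_convexHull ℝ s hx.1, hx.2⟩) ?_)
  · suffices h : convexHull ℝ s ⊆ {x | x ∈ convexHull ℝ s ∧
        (ℓ (homogenize x) = 0 → x ∈ convexHull ℝ {x ∈ s | ℓ (homogenize x) = 0})} from
      fun x hx => (h hx.1).2 hx.2
    refine convexHull_min (fun x hx => ⟨subset_convexHull ℝ s hx, fun h =>
      subset_convexHull ℝ _ ⟨hx, h⟩⟩) ?_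
    rw [convex_iff_forall_pos]
    rintro x ⟨hx, hx'⟩ y ⟨hy, hy'⟩ a b ha hb hab
    refine ⟨convex_convexHull ℝ s hx hy ha.le hb.le hab, fun h => ?_⟩
    rw [homogenize_combo hab, map_add, map_smul, map_smul, smul_eq_mul, smul_eq_mul,
      add_eq_zero_iff_of_nonneg (mul_nonneg ha.le (nonneg_of_mem_convexHull hℓ hx))
        (mul_nonneg hb.le (nonneg_of_mem_convexHull hℓ hy)),
      mul_eq_zero, mul_eq_zero, or_iff_right ha.ne', or_iff_right hb.ne'] at h
    exact convex_convexHull ℝ _ (hx' h.1) (hy' h.2) ha.le hb.le hab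
  · rintro x ⟨hx, hx'⟩ y ⟨hy, hy'⟩ a b ha hb hab
    exact ⟨convex_convexHull ℝ s hx hy ha hb hab, by simp [homogenize_combo hab, hx', hy']⟩

theorem IsSimplicialConfig.convexIndependent (h : IsSimplicialConfig (homogenize '' s)) :
    ConvexIndependent ℝ ((↑) : s → E) := by
  refine convexIndependent_set_iff_notMem_convexHull_sdiff.2 fun x hx hmem => ?_
  obtain ⟨-, ℓ, hzero, hpos⟩ := h.singleton _ ⟨x, hx, rfl⟩
  have hpos' : ∀ y ∈ s \ {x}, 0 < ℓ (homogenize y) := fun y hy =>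
    hpos _ ⟨⟨y, hy.1, rfl⟩, fun h => hy.2 (homogenize_injective h)⟩
  have hx' : x ∈ {y ∈ convexHull ℝ (s \ {x}) | ℓ (homogenize y) = 0} := ⟨hmem, hzero _ rfl⟩
  rw [convexHull_inter_zeros fun y hy => (hpos' y hy).le,
    sep_eq_empty_iff_mem_false.2 fun y hy => (hpos' y hy).ne', convexHull_empty] at hx'
  exact hx'

theorem isExposed_iff_exists_dual {E : Type*} [NormedAddCommGroup E] [NormedSpace ℝ E]
    [FiniteDimensional ℝ E] {C A : Set E} :
    IsExposed ℝ C A ↔ ∃ ℓ : Module.Dual ℝ (E × ℝ), (∀ x ∈ C, 0 ≤ ℓ (homogenize x)) ∧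
      A = {x ∈ C | ℓ (homogenize x) = 0} := by
  constructor
  · intro h
    rcases A.eq_empty_or_nonempty with rfl | hA
    · exact ⟨LinearMap.snd ℝ E ℝ, by simp [homogenize], by simp [homogenize]⟩
    obtain ⟨l, rfl⟩ := h hA
    obtain ⟨x₀, hx₀, hmax⟩ := hA
    refine ⟨l x₀ • LinearMap.snd ℝ E ℝ - l.toLinearMap ∘ₗ LinearMap.fst ℝ E ℝ,
      fun x hx => by simpa [homogenize] using hmax x hx, ?_⟩
    ext x
    simp only [homogenize, mem_ofPred_eq, LinearMap.sub_apply, LinearMap.smul_apply,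
      LinearMap.snd_apply, LinearMap.comp_apply, LinearMap.fst_apply, smul_eq_mul, mul_one,
      ContinuousLinearMap.coe_coe, sub_eq_zero]
    exact and_congr_right fun hx => ⟨fun h => le_antisymm (h x₀ hx₀) (hmax x hx),
      fun h y hy => h ▸ hmax y hy⟩
  · rintro ⟨ℓ, hℓ, rfl⟩ ⟨x₀, hx₀, hzero⟩
    refine ⟨LinearMap.toContinuousLinearMap (-(ℓ ∘ₗ LinearMap.inl ℝ E ℝ)), ?_⟩
    have hsplit : ∀ x, ℓ (homogenize x) = ℓ (x, 0) + ℓ (0, 1) := fun x => by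
      rw [← map_add]; simp [homogenize]
    ext x
    simp only [LinearMap.coe_toContinuousLinearMap', LinearMap.neg_apply, LinearMap.comp_apply,
      LinearMap.inl_apply, neg_le_neg_iff, mem_ofPred_eq]
    refine and_congr_right fun hx => ⟨fun h y hy => ?_, fun h => ?_⟩
    · linarith [hℓ y hy, hsplit x, hsplit y]
    · linarith [h x₀ hx₀, hℓ x hx, hsplit x, hsplit x₀]

section Polytope

variable {E : Type*} [NormedAddCommGroup E] [NormedSpace ℝ E] {s F : Set E}

theorem convexHull_extremePoints_convexHull (hs : s.Finite) :
    convexHull ℝ ((convexHull ℝ s).extremePoints ℝ) = convexHull ℝ s := by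
  have hfin := hs.subset (extremePoints_convexHull_subset (𝕜 := ℝ))
  rw [← (hfin.isCompact_convexHull ℝ).isClosed.closure_eq]
  exact closure_convexHull_extremePoints (hs.isCompact_convexHull ℝ) (convex_convexHull ℝ s)

theorem extremePoints_convexHull_of_convexIndependent (hs : s.Finite)
    (hind : ConvexIndependent ℝ ((↑) : s → E)) : (convexHull ℝ s).extremePoints ℝ = s :=
  extremePoints_convexHull_subset.antisymm fun x hx =>
    convexIndependent_set_iff_inter_convexHull_subset.1 hind _ extremePoints_convexHull_subset
      ⟨hx, by rw [convexHull_extremePoints_convexHull hs]; exact subset_convexHull ℝ s hx⟩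

theorem isConeFace_homogenize_singleton (hs : s.Finite) (hind : ConvexIndependent ℝ ((↑) : s → E))
    {x : E} (hx : x ∈ s) (hne : s ≠ {x}) : IsConeFace (homogenize '' s) {homogenize x} := by
  have hsx : (s \ {x}).Finite := hs.sdiff
  obtain ⟨f, u, hfx, hfu⟩ := geometric_hahn_banach_point_closed (convex_convexHull ℝ (s \ {x}))
    (hsx.isCompact_convexHull ℝ).isClosed
    (convexIndependent_set_iff_notMem_convexHull_sdiff.1 hind x hx)
  rw [← image_singleton, IsConeFace, ← image_sdiff homogenize_injective,
    homogenize_injective.injOn.image_ssubset_image_iff (subset_univ _) s.subset_univ]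
  simp only [forall_mem_image]
  refine ⟨(singleton_subset_iff.2 hx).ssubset_of_ne hne.symm,
    f.toLinearMap ∘ₗ LinearMap.fst ℝ E ℝ - f x • LinearMap.snd ℝ E ℝ, ?_, fun y hy => ?_⟩
  · rintro _ rfl
    simp [homogenize]
  · simpa [homogenize] using hfx.trans (hfu y (subset_convexHull ℝ _ hy))

variable [FiniteDimensional ℝ E]

theorem isConeFace_homogenize_iff (hs : ConvexIndependent ℝ ((↑) : s → E)) (hF : F ⊆ s) :
    IsConeFace (homogenize '' s) (homogenize '' F) ↔
      IsExposed ℝ (convexHull ℝ s) (convexHull ℝ F) ∧ convexHull ℝ F ≠ convexHull ℝ s := by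
  have hmem : ∀ G ⊆ s, s ∩ convexHull ℝ G = G := fun G hG =>
    (convexIndependent_set_iff_inter_convexHull_subset.1 hs G hG).antisymm
      fun x hx => ⟨hG hx, subset_convexHull ℝ G hx⟩
  have hne : convexHull ℝ F ≠ convexHull ℝ s ↔ F ≠ s :=
    not_congr ⟨fun h => by rw [← hmem F hF, h, hmem s subset_rfl], congrArg _⟩
  rw [IsConeFace, homogenize_injective.injOn.image_ssubset_image_iff F.subset_univ s.subset_univ,
    ← image_sdiff homogenize_injective, hne, ssubset_iff_subset_ne, and_iff_right hF, and_comm,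
    isExposed_iff_exists_dual]
  simp only [forall_mem_image]
  refine and_congr_left fun _ => exists_congr fun ℓ => ⟨?_, ?_⟩
  · rintro ⟨hzero, hpos⟩
    have hnonneg : ∀ x ∈ s, 0 ≤ ℓ (homogenize x) := fun x hx => by
      by_cases hxF : x ∈ F
      exacts [(hzero hxF).ge, (hpos ⟨hx, hxF⟩).le]
    refine ⟨fun x => nonneg_of_mem_convexHull hnonneg, ?_⟩
    rw [convexHull_inter_zeros hnonneg]
    congr 1
    ext x
    exact ⟨fun hx => ⟨hF hx, hzero hx⟩, fun hx => by_contra fun hxF => (hpos ⟨hx.1, hxF⟩).ne' hx.2⟩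
  · rintro ⟨hnonneg, hF'⟩
    have hiff : ∀ x ∈ s, x ∈ F ↔ ℓ (homogenize x) = 0 := fun x hx => by
      conv_lhs => rw [← hmem F hF, hF']
      simp [hx, subset_convexHull ℝ s hx]
    exact ⟨fun x hx => (hiff x (hF hx)).1 hx, fun x hx =>
      (hnonneg x (subset_convexHull ℝ s hx.1)).lt_of_ne' (mt (hiff x hx.1).2 hx.2)⟩

theorem exists_eq_convexHull_of_isExposed {A : Set E} (hA : IsExposed ℝ (convexHull ℝ s) A) :
    ∃ F ⊆ s, A = convexHull ℝ F := by
  obtain ⟨ℓ, hnonneg, rfl⟩ := isExposed_iff_exists_dual.1 hA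
  exact ⟨_, sep_subset s _,
    convexHull_inter_zeros fun x hx => hnonneg x (subset_convexHull ℝ s hx)⟩

theorem forall_isConeFace_homogenize_iff (hs : s.Finite)
    (hind : ConvexIndependent ℝ ((↑) : s → E)) :
    (∀ F, IsConeFace (homogenize '' s) F → LinearIndepOn ℝ id F) ↔
      ∀ A, IsExposed ℝ (convexHull ℝ s) A → A ≠ convexHull ℝ s →
        AffineIndependent ℝ ((↑) : A.extremePoints ℝ → E) := by
  have hext : ∀ F ⊆ s, (convexHull ℝ F).extremePoints ℝ = F := fun F hF =>
    extremePoints_convexHull_of_convexIndependent (hs.subset hF) (hind.mono hF)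
  constructor
  · intro h A hA hne
    obtain ⟨F, hF, rfl⟩ := exists_eq_convexHull_of_isExposed hA
    rw [hext F hF]
    exact linearIndepOn_homogenize_image_iff.1
      (h _ ((isConeFace_homogenize_iff hind hF).2 ⟨hA, hne⟩))
  · intro h G hG
    obtain ⟨F, hF, rfl⟩ := subset_image_iff.1 hG.1.subset
    have hA := (isConeFace_homogenize_iff hind hF).1 hG
    have := h _ hA.1 hA.2
    rw [hext F hF] at this
    exact linearIndepOn_homogenize_image_iff.2 this

theorem isSimplicialConfig_homogenize_iff [Nontrivial E] (hs : s.Finite) :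
    IsSimplicialConfig (homogenize '' s) ↔ ConvexIndependent ℝ ((↑) : s → E) ∧
      affineSpan ℝ s = ⊤ ∧ ∀ A, IsExposed ℝ (convexHull ℝ s) A → A ≠ convexHull ℝ s →
        AffineIndependent ℝ ((↑) : A.extremePoints ℝ → E) := by
  constructor
  · intro h
    exact ⟨h.convexIndependent, span_homogenize_eq_top_iff.1 h.span_eq_top,
      (forall_isConeFace_homogenize_iff hs h.convexIndependent).1 h.linearIndepOn⟩
  · rintro ⟨hind, hspan, hface⟩
    have hnontrivial : s.Nontrivial := by
      by_contra hsub
      have htop :=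
        (AffineSubspace.affineSpan_eq_top_iff_vectorSpan_eq_top_of_nontrivial ℝ E E).1 hspan
      rw [vectorSpan_of_subsingleton ℝ (not_nontrivial_iff.1 hsub)] at htop
      exact bot_ne_top htop
    exact
      { finite := hs.image _
        span_eq_top := span_homogenize_eq_top_iff.2 hspan
        empty := ⟨(hnontrivial.nonempty.image _).empty_ssubset, LinearMap.snd ℝ E ℝ, by simp,
          by simp [homogenize]⟩
        singleton := by
          rintro _ ⟨x, hx, rfl⟩
          exact isConeFace_homogenize_singleton hs hind hx hnontrivial.ne_singleton
        linearIndepOn := (forall_isConeFace_homogenize_iff hs hind).2 hface }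

end Polytope

end Homogenization

section Realization

variable {V W : Type*} [AddCommGroup V] [Module ℝ V] [AddCommGroup W] [Module ℝ W] {S : Set V}

theorem exists_linearEquiv_prod {K V E : Type*} [Field K] [AddCommGroup V] [Module K V]
    [FiniteDimensional K V] [AddCommGroup E] [Module K E] [FiniteDimensional K E]
    (hdim : Module.finrank K V = Module.finrank K E + 1) {f : V →ₗ[K] E} {ω : Module.Dual K V}
    (hω : ω ≠ 0) (hf : ∀ x, ∃ v, ω v = 0 ∧ f v = x) :
    ∃ A : V ≃ₗ[K] E × K, ∀ v, A v = (f v, ω v) := by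
  have hsurj : Function.Surjective (f.prod ω) := by
    rintro ⟨x, c⟩
    obtain ⟨u, hu⟩ := LinearMap.surjective hω c
    obtain ⟨v, hv, hfv⟩ := hf (x - f u)
    exact ⟨u + v, by simp [hu, hv, hfv]⟩
  have hinj := (LinearMap.injective_iff_surjective_of_finrank_eq_finrank
    (by rw [hdim, Module.finrank_prod, Module.finrank_self])).2 hsurj
  exact ⟨LinearEquiv.ofBijective _ ⟨hinj, hsurj⟩, fun v => rfl⟩

theorem exists_linearEquiv_prod_snd_eq {K V E : Type*} [Field K] [AddCommGroup V] [Module K V]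
    [FiniteDimensional K V] [AddCommGroup E] [Module K E] [FiniteDimensional K E]
    (hdim : Module.finrank K V = Module.finrank K E + 1) {ω : Module.Dual K V} (hω : ω ≠ 0) :
    ∃ A : V ≃ₗ[K] E × K, ∀ v, (A v).2 = ω v := by
  have hker := Module.Dual.finrank_ker_add_one_of_ne_zero hω
  let g : LinearMap.ker ω ≃ₗ[K] E := LinearEquiv.ofFinrankEq _ _ (by lia)
  obtain ⟨f, hf⟩ := LinearMap.exists_extend g.toLinearMap
  obtain ⟨A, hA⟩ := exists_linearEquiv_prod hdim (f := f) hω fun x =>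
    ⟨g.symm x, (g.symm x).2, by simpa using LinearMap.congr_fun hf (g.symm x)⟩
  exact ⟨A, fun v => by rw [hA]⟩

theorem IsSimplicialConfig.exists_image_smul_eq_image_homogenize {E : Type*} [AddCommGroup E]
    [Module ℝ E] [FiniteDimensional ℝ V] [FiniteDimensional ℝ E]
    (hdim : Module.finrank ℝ V = Module.finrank ℝ E + 1) (hS : IsSimplicialConfig S) :
    ∃ (A : V ≃ₗ[ℝ] E × ℝ) (c : V → ℝ) (s : Set E), (∀ v ∈ S, 0 < c v) ∧
      A '' ((fun v => c v • v) '' S) = homogenize '' s := by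
  obtain ⟨hne, ω, -, hω⟩ := hS.empty
  rw [Set.sdiff_empty] at hω
  obtain ⟨v₀, hv₀, -⟩ := Set.exists_of_ssubset hne
  obtain ⟨A, hA⟩ := exists_linearEquiv_prod_snd_eq (E := E) hdim
    (ω := ω) fun h => (hω v₀ hv₀).ne' (by simp [h])
  refine ⟨A, fun v => (ω v)⁻¹, (fun v => (ω v)⁻¹ • (A v).1) '' S,
    fun v hv => inv_pos.2 (hω v hv), ?_⟩
  rw [Set.image_image, Set.image_image]
  refine Set.image_congr fun v hv => Prod.ext ?_ ?_
  · simp [homogenize]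
  · simp [homogenize, hA, (hω v hv).ne']

end Realization

namespace SimplicialPolytope

variable {P : SimplicialPolytope}

theorem finite_extremePoints (P : SimplicialPolytope) : (Set.extremePoints ℝ P.carrier).Finite := by
  obtain ⟨s, hs⟩ := P.exists_finset
  exact s.finite_toSet.subset (hs ▸ extremePoints_convexHull_subset)

instance : Finite P.Vertex := P.finite_extremePoints

theorem convexHull_extremePoints (P : SimplicialPolytope) :
    convexHull ℝ (Set.extremePoints ℝ P.carrier) = P.carrier := by
  obtain ⟨s, hs⟩ := P.exists_finset
  rw [hs, convexHull_extremePoints_convexHull s.finite_toSet]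

theorem convexIndependent_extremePoints (P : SimplicialPolytope) :
    ConvexIndependent ℝ ((↑) : Set.extremePoints ℝ P.carrier → EuclideanSpace ℝ (Fin 3)) := by
  refine Convex.convexIndependent_extremePoints ?_
  rw [← P.convexHull_extremePoints]
  exact convex_convexHull ℝ _

variable {V W : Type*} [AddCommGroup V] [Module ℝ V] [AddCommGroup W] [Module ℝ W]

/-- `φ` identifies the boundary complex of `P` with that of a simplicial configuration of vectors:
vertices become vectors and faces of `P` become faces of the configuration. -/
structure IsVectorModel (P : SimplicialPolytope) (φ : P.Vertex → V) : Prop where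
  injective : Function.Injective φ
  isSimplicialConfig : IsSimplicialConfig (Set.range φ)
  isFace_iff : ∀ σ, P.IsFace σ ↔ IsConeFace (Set.range φ) (φ '' σ)

theorem isVectorModel_homogenize (P : SimplicialPolytope) :
    P.IsVectorModel fun v : P.Vertex => homogenize (v : EuclideanSpace ℝ (Fin 3)) := by
  have hrange : Set.range (fun v : P.Vertex => homogenize (v : EuclideanSpace ℝ (Fin 3))) =
      homogenize '' Set.extremePoints ℝ P.carrier := by
    rw [Set.image_eq_range]
  refine ⟨homogenize_injective.comp Subtype.val_injective, ?_, fun σ => ?_⟩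
  · rw [hrange, isSimplicialConfig_homogenize_iff P.finite_extremePoints,
      P.convexHull_extremePoints]
    refine ⟨P.convexIndependent_extremePoints, ?_, P.simplicial⟩
    rw [← interior_convexHull_nonempty_iff_affineSpan_eq_top, P.convexHull_extremePoints]
    exact P.interior_nonempty
  · have hσ : Subtype.val '' σ ⊆ Set.extremePoints ℝ P.carrier := Subtype.coe_image_subset _ σ
    rw [hrange, ← Set.image_image homogenize Subtype.val, isConeFace_homogenize_iff
      P.convexIndependent_extremePoints hσ, P.convexHull_extremePoints, IsFace]

theorem IsVectorModel.comp_equiv {φ : P.Vertex → V} (hφ : P.IsVectorModel φ) (A : V ≃ₗ[ℝ] W) :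
    P.IsVectorModel (A ∘ φ) where
  injective := A.injective.comp hφ.injective
  isSimplicialConfig := Set.range_comp A φ ▸ hφ.isSimplicialConfig.image_equiv A
  isFace_iff σ := by
    rw [hφ.isFace_iff, Set.range_comp, Set.image_comp, isConeFace_image_equiv_iff]

theorem IsVectorModel.exists_of_range_eq_image_smul {φ : P.Vertex → V} (hφ : P.IsVectorModel φ)
    {S : Set V} (hS : IsSimplicialConfig S) {c : V → ℝ} (hc : ∀ v ∈ S, 0 < c v)
    (hrange : Set.range φ = (fun v => c v • v) '' S) :
    ∃ ψ : P.Vertex → V, P.IsVectorModel ψ ∧ Set.range ψ = S := by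
  choose ψ hψS hψ using fun x => hrange.subset (Set.mem_range_self x)
  have hψrange : Set.range ψ = S := by
    refine Set.Subset.antisymm (Set.range_subset_iff.2 hψS) fun v hv => ?_
    obtain ⟨x, hx⟩ := hrange.symm.subset (Set.mem_image_of_mem _ hv)
    exact ⟨x, hS.injOn_smul hc (hψS x) hv ((hψ x).trans hx)⟩
  refine ⟨ψ, ⟨fun x y hxy => hφ.injective ?_, hψrange ▸ hS, fun σ => ?_⟩, hψrange⟩
  · rw [← hψ x, ← hψ y, hxy]
  · rw [hφ.isFace_iff, hψrange, hrange, ← isConeFace_image_smul_iff hc (hS.injOn_smul hc)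
      (hψrange ▸ Set.image_subset_range ψ σ), Set.image_image]
    simp only [hψ]

theorem exists_extremePoints_eq {s : Set (EuclideanSpace ℝ (Fin 3))}
    (hs : IsSimplicialConfig (homogenize '' s)) :
    ∃ P : SimplicialPolytope, Set.extremePoints ℝ P.carrier = s := by
  have hfin : s.Finite := Set.Finite.of_finite_image hs.finite homogenize_injective.injOn
  obtain ⟨hind, hspan, hface⟩ := (isSimplicialConfig_homogenize_iff hfin).1 hs
  refine ⟨⟨convexHull ℝ s, ⟨hfin.toFinset, by rw [hfin.coe_toFinset]⟩, ?_, hface⟩,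
    extremePoints_convexHull_of_convexIndependent hfin hind⟩
  rwa [interior_convexHull_nonempty_iff_affineSpan_eq_top]

theorem exists_isVectorModel {S : Set V} (hdim : Module.finrank ℝ V = 4)
    (hS : IsSimplicialConfig S) :
    ∃ (P : SimplicialPolytope) (φ : P.Vertex → V), P.IsVectorModel φ ∧ Set.range φ = S := by
  have : FiniteDimensional ℝ V := FiniteDimensional.of_finrank_pos (by lia)
  obtain ⟨A, c, s, hc, hs⟩ := hS.exists_image_smul_eq_image_homogenize
    (E := EuclideanSpace ℝ (Fin 3)) (by rw [hdim, finrank_euclideanSpace_fin])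
  obtain ⟨P, hP⟩ := exists_extremePoints_eq (hs ▸ (hS.image_smul hc).image_equiv A)
  refine ⟨P, (P.isVectorModel_homogenize.comp_equiv A.symm).exists_of_range_eq_image_smul hS hc ?_⟩
  rw [Set.range_comp, ← Set.image_eq_range, hP, ← hs]
  exact A.toEquiv.symm_image_image _

theorem IsFace.mono {σ τ : Set P.Vertex} (hσ : P.IsFace σ) (h : τ ⊆ σ) : P.IsFace τ := by
  have hφ := P.isVectorModel_homogenize
  rw [hφ.isFace_iff] at hσ ⊢
  exact hφ.isSimplicialConfig.isConeFace_mono hσ (Set.image_mono h)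

end SimplicialPolytope

section Split

open Set

variable {κ : Type*} [DecidableEq κ] {S T F : Set ((κ → ℝ) × ℝ)} {ε : ℝ}

/-- The vertices of the standard simplex in the hyperplane on which the last coordinate vanishes. -/
def baseVector (k : κ) : (κ → ℝ) × ℝ := (Pi.single k 1, 0)

theorem baseVector_injective : Function.Injective (baseVector : κ → (κ → ℝ) × ℝ) :=
  fun k l h => by simpa [baseVector, Pi.single_apply] using congrFun (congrArg Prod.fst h) k

/-- `S` contains the base vectors, and its other vectors project into the interior of the cone over
the base simplex and lie on one side of the base hyperplane: above it if `ε` is positive, below it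
if `ε` is negative. -/
structure IsOnSide (ε : ℝ) (S : Set ((κ → ℝ) × ℝ)) : Prop where
  base_subset : range baseVector ⊆ S
  fst_pos : ∀ v ∈ S \ range baseVector, ∀ k, 0 < v.1 k
  snd_pos : ∀ v ∈ S \ range baseVector, 0 < ε * v.2
  nonempty : (S \ range baseVector).Nonempty

theorem IsOnSide.snd_mul_neg (hS : IsOnSide ε S) (hT : IsOnSide (-ε) T) {v w : (κ → ℝ) × ℝ}
    (hv : v ∈ S \ range baseVector) (hw : w ∈ T \ range baseVector) : v.2 * w.2 < 0 := by
  have := mul_pos (hS.snd_pos v hv) (hT.snd_pos w hw)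
  nlinarith [sq_nonneg ε]

theorem IsOnSide.snd_ne_zero (hS : IsOnSide ε S) {v : (κ → ℝ) × ℝ}
    (hv : v ∈ S \ range baseVector) : v.2 ≠ 0 :=
  right_ne_zero_of_mul (hS.snd_pos v hv).ne'

theorem IsOnSide.inter_eq (hS : IsOnSide ε S) (hT : IsOnSide (-ε) T) :
    S ∩ T = range baseVector := by
  refine Subset.antisymm (fun v hv => ?_) (subset_inter hS.base_subset hT.base_subset)
  by_contra hbase
  exact (hS.snd_mul_neg hT ⟨hv.1, hbase⟩ ⟨hv.2, hbase⟩).not_ge (mul_self_nonneg _)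

theorem IsOnSide.isConeFace_range_baseVector (hS : IsOnSide ε S) :
    IsConeFace S (range baseVector) := by
  refine ⟨hS.base_subset.ssubset_of_ne ?_, ε • LinearMap.snd ℝ (κ → ℝ) ℝ, ?_, hS.snd_pos⟩
  · obtain ⟨v, hv⟩ := hS.nonempty
    exact fun h => hv.2 (h ▸ hv.1)
  · rintro _ ⟨k, rfl⟩
    simp [baseVector]

theorem dual_apply_eq_sum [Fintype κ] (ℓ : Module.Dual ℝ ((κ → ℝ) × ℝ)) (v : (κ → ℝ) × ℝ) :
    ℓ v = ∑ k, v.1 k * ℓ (baseVector k) + v.2 * ℓ (0, 1) := by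
  have h : v = ∑ k, v.1 k • baseVector k + v.2 • ((0, 1) : (κ → ℝ) × ℝ) := by
    ext k
    · simp [baseVector, Prod.fst_sum, Finset.sum_apply, Pi.single_apply]
    · simp [baseVector, Prod.snd_sum]
  conv_lhs => rw [h]
  simp only [map_add, map_sum, map_smul, smul_eq_mul]

variable [Finite κ]

theorem dual_pos_of_nonneg {ℓ : Module.Dual ℝ ((κ → ℝ) × ℝ)} (hℓ : ℓ ≠ 0)
    (hbase : ∀ k, 0 ≤ ℓ (baseVector k)) {v : (κ → ℝ) × ℝ} (hv : ∀ k, 0 < v.1 k) (hv' : v.2 ≠ 0)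
    (hlast : 0 ≤ v.2 * ℓ (0, 1)) : 0 < ℓ v := by
  cases nonempty_fintype κ
  have hterm : ∀ k ∈ Finset.univ, 0 ≤ v.1 k * ℓ (baseVector k) :=
    fun k _ => mul_nonneg (hv k).le (hbase k)
  rw [dual_apply_eq_sum]
  refine (add_nonneg (Finset.sum_nonneg hterm) hlast).lt_of_ne' fun h => hℓ ?_
  rw [add_eq_zero_iff_of_nonneg (Finset.sum_nonneg hterm) hlast, Finset.sum_eq_zero_iff_of_nonneg
    hterm, mul_eq_zero, or_iff_right hv'] at h
  have hzero : ∀ k, ℓ (baseVector k) = 0 := fun k =>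
    (mul_eq_zero.1 (h.1 k (Finset.mem_univ k))).resolve_left (hv k).ne'
  exact LinearMap.ext fun w => by rw [dual_apply_eq_sum]; simp [hzero, h.2]

theorem linearIndepOn_range_baseVector :
    LinearIndepOn ℝ id (range (baseVector : κ → (κ → ℝ) × ℝ)) := by
  cases nonempty_fintype κ
  rw [linearIndepOn_id_range_iff baseVector_injective, Fintype.linearIndependent_iff]
  intro c hc k
  simpa [baseVector, Prod.fst_sum, Finset.sum_apply, Pi.single_apply] using
    congrFun (congrArg Prod.fst hc) k

theorem IsOnSide.span_eq_top (hS : IsOnSide ε S) : Submodule.span ℝ S = ⊤ := by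
  cases nonempty_fintype κ
  obtain ⟨v, hv⟩ := hS.nonempty
  have hbase : ∀ x : κ → ℝ, (x, (0 : ℝ)) ∈ Submodule.span ℝ S := fun x => by
    have : (x, (0 : ℝ)) = ∑ k, x k • baseVector k := by
      ext k
      · simp [baseVector, Prod.fst_sum, Finset.sum_apply, Pi.single_apply]
      · simp [baseVector, Prod.snd_sum]
    exact this ▸ Submodule.sum_mem _ fun k _ =>
      Submodule.smul_mem _ _ (Submodule.subset_span (hS.base_subset ⟨k, rfl⟩))
  refine eq_top_iff.2 fun w _ => ?_
  have hw : w = (w.2 / v.2) • v + (w.1 - (w.2 / v.2) • v.1, 0) := by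
    ext <;> simp [hS.snd_ne_zero hv]
  exact hw ▸ Submodule.add_mem _ (Submodule.smul_mem _ _ (Submodule.subset_span hv.1)) (hbase _)

theorem isConeFace_of_ssubset_range_baseVector (hbase : range baseVector ⊆ S)
    (hpos : ∀ v ∈ S \ range baseVector, ∀ k, 0 < v.1 k) (hF : F ⊂ range baseVector) :
    IsConeFace S F := by
  classical
  cases nonempty_fintype κ
  obtain ⟨_, ⟨k₀, rfl⟩, hk₀⟩ := exists_of_ssubset hF
  let ℓ : Module.Dual ℝ ((κ → ℝ) × ℝ) :=
    ∑ k with baseVector k ∉ F, LinearMap.proj k ∘ₗ LinearMap.fst ℝ (κ → ℝ) ℝ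
  have hℓ : ∀ v, ℓ v = ∑ k with baseVector k ∉ F, v.1 k := fun v => by simp [ℓ]
  have hℓ_base : ∀ k, ℓ (baseVector k) = if baseVector k ∈ F then 0 else 1 := fun k => by
    rw [hℓ]
    exact (Finset.sum_pi_single' k _ _).trans (by simp)
  refine ⟨hF.trans_subset hbase, ℓ, fun v hv => ?_, fun v hv => ?_⟩
  · obtain ⟨k, rfl⟩ := hF.subset hv
    rw [hℓ_base, if_pos hv]
  · by_cases hv' : v ∈ range baseVector
    · obtain ⟨k, rfl⟩ := hv'
      rw [hℓ_base, if_neg hv.2]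
      exact one_pos
    · rw [hℓ]
      exact Finset.sum_pos (fun k _ => hpos v ⟨hv.1, hv'⟩ k) ⟨k₀, by simpa using hk₀⟩

theorem IsConeFace.union_of_isOnSide (hF : IsConeFace S F) (hne : F ≠ range baseVector)
    (hS : IsOnSide ε S) (hT : IsOnSide (-ε) T) : IsConeFace (S ∪ T) F := by
  by_cases hbase : F ⊆ range baseVector
  · refine isConeFace_of_ssubset_range_baseVector (subset_union_of_subset_left hS.base_subset T) ?_
      (hbase.ssubset_of_ne hne)
    rintro v ⟨hv | hv, hv'⟩
    exacts [hS.fst_pos v ⟨hv, hv'⟩, hT.fst_pos v ⟨hv, hv'⟩]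
  obtain ⟨v, hvF, hv⟩ := not_subset.1 hbase
  obtain ⟨hFS, ℓ, hzero, hpos⟩ := hF
  obtain ⟨u, hu⟩ := exists_of_ssubset hFS
  have hℓ : ℓ ≠ 0 := fun h => (hpos u hu).ne' (by simp [h])
  have hnonneg : ∀ k, 0 ≤ ℓ (baseVector k) := fun k => by
    by_cases hk : baseVector k ∈ F
    exacts [(hzero _ hk).ge, (hpos _ ⟨hS.base_subset ⟨k, rfl⟩, hk⟩).le]
  have hv_last : v.2 * ℓ (0, 1) < 0 := by
    by_contra! h
    exact (dual_pos_of_nonneg hℓ hnonneg (hS.fst_pos v ⟨hFS.subset hvF, hv⟩)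
      (hS.snd_ne_zero ⟨hFS.subset hvF, hv⟩) h).ne' (hzero v hvF)
  refine ⟨hFS.trans_subset subset_union_left, ℓ, hzero, fun w hw => ?_⟩
  by_cases hwS : w ∈ S
  · exact hpos w ⟨hwS, hw.2⟩
  have hwT : w ∈ T \ range baseVector := ⟨hw.1.resolve_left hwS, fun h => hwS (hS.base_subset h)⟩
  refine dual_pos_of_nonneg hℓ hnonneg (hT.fst_pos w hwT) (hT.snd_ne_zero hwT) ?_
  nlinarith [mul_pos_of_neg_of_neg hv_last (hS.snd_mul_neg hT ⟨hFS.subset hvF, hv⟩ hwT),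
    sq_nonneg v.2]

theorem not_range_baseVector_subset_of_isConeFace_union (hF : IsConeFace (S ∪ T) F)
    (hS : IsOnSide ε S) (hT : IsOnSide (-ε) T) : ¬ range baseVector ⊆ F := by
  cases nonempty_fintype κ
  intro hbase
  obtain ⟨hFS, ℓ, hzero, hpos⟩ := hF
  have hzero_base : ∀ k, ℓ (baseVector k) = 0 := fun k => hzero _ (hbase ⟨k, rfl⟩)
  have hℓ : ∀ v, ℓ v = v.2 * ℓ (0, 1) := fun v => by
    rw [dual_apply_eq_sum]; simp [hzero_base]
  have hnonneg : ∀ v ∈ S ∪ T, 0 ≤ v.2 * ℓ (0, 1) := fun v hv => by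
    rw [← hℓ]
    by_cases hvF : v ∈ F
    exacts [(hzero v hvF).ge, (hpos v ⟨hv, hvF⟩).le]
  obtain ⟨u, hu⟩ := exists_of_ssubset hFS
  have hu_pos : ℓ (0, 1) ≠ 0 := fun h => (hpos u hu).ne' (by rw [hℓ, h, mul_zero])
  obtain ⟨v, hv⟩ := hS.nonempty
  obtain ⟨w, hw⟩ := hT.nonempty
  nlinarith [mul_nonneg (hnonneg v (.inl hv.1)) (hnonneg w (.inr hw.1)),
    mul_neg_of_neg_of_pos (hS.snd_mul_neg hT hv hw) (sq_pos_of_ne_zero hu_pos)]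

theorem subset_of_dual_last_nonpos {ℓ : Module.Dual ℝ ((κ → ℝ) × ℝ)} (hFS : F ⊂ S ∪ T)
    (hzero : ∀ v ∈ F, ℓ v = 0) (hpos : ∀ v ∈ (S ∪ T) \ F, 0 < ℓ v) (hlast : ε * ℓ (0, 1) ≤ 0)
    (hS : range baseVector ⊆ S) (hT : IsOnSide (-ε) T) : F ⊆ S := by
  intro w hw
  by_contra hwS
  obtain ⟨u, hu⟩ := exists_of_ssubset hFS
  have hwT : w ∈ T \ range baseVector :=
    ⟨(hFS.subset hw).resolve_left hwS, fun h => hwS (hS h)⟩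
  have hnonneg : ∀ k, 0 ≤ ℓ (baseVector k) := fun k => by
    by_cases hk : baseVector k ∈ F
    exacts [(hzero _ hk).ge, (hpos _ ⟨.inl (hS ⟨k, rfl⟩), hk⟩).le]
  have hlast' : 0 ≤ w.2 * ℓ (0, 1) := by
    refine nonneg_of_mul_nonneg_left (b := ε ^ 2) ?_
      (sq_pos_of_ne_zero (neg_ne_zero.1 (left_ne_zero_of_mul (hT.snd_pos w hwT).ne')))
    nlinarith [mul_nonneg (hT.snd_pos w hwT).le (neg_nonneg.2 hlast)]
  exact (dual_pos_of_nonneg (fun h => (hpos u hu).ne' (by simp [h])) hnonneg (hT.fst_pos w hwT)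
    (hT.snd_ne_zero hwT) hlast').ne' (hzero w hw)

theorem isConeFace_union_iff (hS : IsOnSide ε S) (hT : IsOnSide (-ε) T) :
    IsConeFace (S ∪ T) F ↔ (IsConeFace S F ∨ IsConeFace T F) ∧ F ≠ range baseVector := by
  have hS' : IsOnSide (- -ε) S := by rwa [neg_neg]
  constructor
  · intro hF
    have hbase := not_range_baseVector_subset_of_isConeFace_union hF hS hT
    refine ⟨?_, fun h => hbase h.ge⟩
    obtain ⟨hFST, ℓ, hzero, hpos⟩ := id hF
    rcases le_total (ε * ℓ (0, 1)) 0 with hlast | hlast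
    · have hFS := subset_of_dual_last_nonpos hFST hzero hpos hlast hS.base_subset hT
      exact .inl (hF.restrict subset_union_left
        (hFS.ssubset_of_ne fun h => hbase (h ▸ hS.base_subset)))
    · rw [union_comm] at hFST hpos
      have hFT := subset_of_dual_last_nonpos hFST hzero hpos
        (by rw [neg_mul]; exact neg_nonpos.2 hlast) hT.base_subset hS'
      exact .inr (hF.restrict subset_union_right
        (hFT.ssubset_of_ne fun h => hbase (h ▸ hT.base_subset)))
  · rintro ⟨hF | hF, hne⟩
    · exact hF.union_of_isOnSide hne hS hT
    · exact union_comm T S ▸ hF.union_of_isOnSide hne hT hS'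

theorem IsSimplicialConfig.of_union_left [Nonempty κ] (h : IsSimplicialConfig (S ∪ T))
    (hS : IsOnSide ε S) (hT : IsOnSide (-ε) T) : IsSimplicialConfig S where
  finite := h.finite.subset subset_union_left
  span_eq_top := hS.span_eq_top
  empty := h.empty.restrict subset_union_left (hS.nonempty.mono sdiff_subset).empty_ssubset
  singleton v hv := by
    refine (h.singleton v (.inl hv)).restrict subset_union_left
      ((singleton_subset_iff.2 hv).ssubset_of_ne ?_)
    obtain ⟨w, hw⟩ := hS.nonempty
    rintro hSv
    obtain ⟨k⟩ := ‹Nonempty κ›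
    have hk := hSv.ge (hS.base_subset ⟨k, rfl⟩)
    exact hw.2 ⟨k, hk.trans (hSv.ge hw.1).symm⟩
  linearIndepOn F hF := by
    by_cases hne : F = range baseVector
    · exact hne ▸ linearIndepOn_range_baseVector
    · exact h.linearIndepOn F (hF.union_of_isOnSide hne hS hT)

theorem isSimplicialConfig_union_iff [Nontrivial κ] (hS : IsOnSide ε S) (hT : IsOnSide (-ε) T) :
    IsSimplicialConfig (S ∪ T) ↔ IsSimplicialConfig S ∧ IsSimplicialConfig T := by
  refine ⟨fun h => ⟨h.of_union_left hS hT, ?_⟩, fun ⟨hS', hT'⟩ => ?_⟩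
  · exact (union_comm S T ▸ h).of_union_left hT (by rwa [neg_neg])
  obtain ⟨k, l, hkl⟩ := exists_pair_ne κ
  have hbase : ∀ v, {v} ≠ range (baseVector : κ → (κ → ℝ) × ℝ) := fun v hv =>
    hkl (baseVector_injective ((hv.ge ⟨k, rfl⟩).trans (hv.ge ⟨l, rfl⟩).symm))
  refine ⟨hS'.finite.union hT'.finite, ?_, ?_, ?_, ?_⟩
  · exact eq_top_iff.2 (hS.span_eq_top ▸ Submodule.span_mono subset_union_left)
  · exact (isConeFace_union_iff hS hT).2 ⟨.inl hS'.empty, (range_nonempty _).ne_empty.symm⟩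
  · rintro v (hv | hv)
    exacts [(isConeFace_union_iff hS hT).2 ⟨.inl (hS'.singleton v hv), hbase v⟩,
      (isConeFace_union_iff hS hT).2 ⟨.inr (hT'.singleton v hv), hbase v⟩]
  · intro F hF
    rcases ((isConeFace_union_iff hS hT).1 hF).1 with hF | hF
    exacts [hS'.linearIndepOn F hF, hT'.linearIndepOn F hF]

end Split

section Coordinates

open Set Module

variable {κ V : Type*} [DecidableEq κ] [AddCommGroup V] [Module ℝ V]

theorem image_sdiff_range_baseVector {t : κ → V} {A : V ≃ₗ[ℝ] (κ → ℝ) × ℝ}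
    (hA : ∀ k, A (t k) = baseVector k) (S : Set V) :
    A '' S \ range baseVector = A '' (S \ range t) := by
  rw [image_sdiff A.injective, ← range_comp, show A ∘ t = baseVector from funext hA]

theorem IsSimplicialConfig.range_baseVector_ssubset {S : Set ((κ → ℝ) × ℝ)}
    (hS : IsSimplicialConfig S) (hbase : range baseVector ⊆ S) : range baseVector ⊂ S := by
  refine hbase.ssubset_of_ne fun h => one_ne_zero (α := ℝ) ?_
  have hsnd : LinearMap.snd ℝ (κ → ℝ) ℝ = 0 := LinearMap.ext_on hS.span_eq_top <| by
    rw [← h]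
    rintro _ ⟨k, rfl⟩
    simp [baseVector]
  exact LinearMap.congr_fun hsnd (0, 1)

theorem isOnSide_sep {S : Set ((κ → ℝ) × ℝ)} (hbase : range baseVector ⊂ S)
    (hfst : ∀ v ∈ S \ range baseVector, ∀ k, 0 < v.1 k)
    (hsnd : ∀ v ∈ S \ range baseVector, v.2 ≠ 0) (hmissing : ¬ IsConeFace S (range baseVector))
    {ε : ℝ} (hε : ε ≠ 0) : IsOnSide ε {v ∈ S | v ∈ range baseVector ∨ 0 < ε * v.2} where
  base_subset := fun v hv => ⟨hbase.subset hv, .inl hv⟩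
  fst_pos := fun v hv => hfst v ⟨hv.1.1, hv.2⟩
  snd_pos := fun v hv => hv.1.2.resolve_left hv.2
  nonempty := by
    by_contra! hempty
    refine hmissing ⟨hbase, -ε • LinearMap.snd ℝ (κ → ℝ) ℝ, ?_, fun v hv => ?_⟩
    · rintro _ ⟨k, rfl⟩
      simp [baseVector]
    · have hnonpos : ¬ 0 < ε * v.2 := fun h =>
        hempty.subset ⟨⟨hv.1, .inr h⟩, hv.2⟩
      have hneg := (not_lt.1 hnonpos).lt_of_ne (mul_ne_zero hε (hsnd v hv))
      simpa using hneg

theorem IsSimplicialConfig.snd_ne_zero [Finite κ] [Nonempty κ] {S : Set ((κ → ℝ) × ℝ)}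
    (hS : IsSimplicialConfig S) (hbase : range baseVector ⊆ S) {v : (κ → ℝ) × ℝ}
    (hv : v ∈ S \ range baseVector) (hfst : ∀ k, 0 < v.1 k) : v.2 ≠ 0 := by
  cases nonempty_fintype κ
  intro h
  obtain ⟨-, ℓ, hzero, hpos⟩ := hS.singleton v hv.1
  have hsum : 0 < ∑ k, v.1 k * ℓ (baseVector k) := Finset.sum_pos (fun k _ =>
    mul_pos (hfst k) (hpos _ ⟨hbase ⟨k, rfl⟩, fun hk => hv.2 ⟨k, hk⟩⟩)) Finset.univ_nonempty
  exact hsum.ne' (by simpa [h, hzero v rfl] using (dual_apply_eq_sum ℓ v).symm)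

variable [Fintype κ]

theorem exists_linearEquiv_eq_baseVector (hdim : finrank ℝ V = Fintype.card κ + 1) {S : Set V}
    {t : κ → V} (ht : Function.Injective t) (htS : range t ⊆ S)
    (hface : ∀ k, IsConeFace S (range t \ {t k})) {ω : Dual ℝ V} (hω : ω ≠ 0)
    (hωt : ∀ k, ω (t k) = 0) :
    ∃ A : V ≃ₗ[ℝ] (κ → ℝ) × ℝ, (∀ k, A (t k) = baseVector k) ∧
      (∀ v ∈ S \ range t, ∀ k, 0 < (A v).1 k) ∧ ∀ v, (A v).2 = ω v := by
  have : FiniteDimensional ℝ V := FiniteDimensional.of_finrank_pos (by lia)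
  choose _ X hzero hpos using hface
  have hX : ∀ k, 0 < X k (t k) := fun k => hpos k _ ⟨htS ⟨k, rfl⟩, fun h => h.2 rfl⟩
  let f : V →ₗ[ℝ] κ → ℝ := LinearMap.pi fun k => (X k (t k))⁻¹ • X k
  have hf : ∀ k, f (t k) = Pi.single k 1 := fun k => funext fun l => by
    rcases eq_or_ne l k with rfl | hlk
    · simp [f, (hX l).ne']
    · simp [f, hlk, hzero l (t k) ⟨⟨k, rfl⟩, ht.ne hlk.symm⟩]
  obtain ⟨A, hA⟩ := exists_linearEquiv_prod (f := f) (by simpa using hdim) hω fun x => by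
    refine ⟨∑ k, x k • t k, by simp [hωt], ?_⟩
    simp only [map_sum, map_smul, hf]
    exact (pi_eq_sum_univ' x).symm
  refine ⟨A, fun k => by rw [hA, hf, hωt, baseVector], fun v hv k => ?_, fun v => by rw [hA]⟩
  rw [hA]
  exact mul_pos (inv_pos.2 (hX k)) (hpos k v ⟨hv.1, fun h => hv.2 h.1⟩)

theorem IsSimplicialConfig.exists_isOnSide_image (hdim : finrank ℝ V = Fintype.card κ + 1)
    {S : Set V} (hS : IsSimplicialConfig S) {t : κ → V} (ht : Function.Injective t)
    (hface : IsConeFace S (range t)) {ε : ℝ} (hε : ε ≠ 0) :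
    ∃ A : V ≃ₗ[ℝ] (κ → ℝ) × ℝ, (∀ k, A (t k) = baseVector k) ∧ IsOnSide ε (A '' S) := by
  obtain ⟨hts, ℓ, hzero, hpos⟩ := id hface
  obtain ⟨u, hu⟩ := exists_of_ssubset hts
  have hω : ε • ℓ ≠ 0 := smul_ne_zero hε fun h => (hpos u hu).ne' (by simp [h])
  obtain ⟨A, hAt, hfst, hsnd⟩ := exists_linearEquiv_eq_baseVector hdim ht hts.subset
    (fun k => hS.isConeFace_mono hface sdiff_subset) hω fun k => by simp [hzero (t k) ⟨k, rfl⟩]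
  refine ⟨A, hAt, range_subset_iff.2 fun k => ⟨t k, hts.subset ⟨k, rfl⟩, hAt k⟩, ?_, ?_, ?_⟩ <;>
    rw [image_sdiff_range_baseVector hAt]
  · exact forall_mem_image.2 fun v hv => hfst v hv
  · refine forall_mem_image.2 fun v hv => ?_
    rw [hsnd, LinearMap.smul_apply, smul_eq_mul, ← mul_assoc]
    exact mul_pos (mul_self_pos.2 hε) (hpos v hv)
  · exact Nonempty.image A ⟨u, hu⟩

theorem IsSimplicialConfig.exists_image_eq_union [Nonempty κ]
    (hdim : finrank ℝ V = Fintype.card κ + 1) {S : Set V} (hS : IsSimplicialConfig S)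
    {t : κ → V} (ht : Function.Injective t) (htS : range t ⊆ S)
    (hface : ∀ k, IsConeFace S (range t \ {t k})) (hmissing : ¬ IsConeFace S (range t)) :
    ∃ (A : V ≃ₗ[ℝ] (κ → ℝ) × ℝ) (U L : Set ((κ → ℝ) × ℝ)), (∀ k, A (t k) = baseVector k) ∧
      IsOnSide 1 U ∧ IsOnSide (-1) L ∧ A '' S = U ∪ L := by
  have : FiniteDimensional ℝ V := FiniteDimensional.of_finrank_pos (by lia)
  have hspan : Submodule.span ℝ (range t) < ⊤ := by
    refine lt_top_iff_ne_top.2 fun h => ?_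
    have := finrank_range_le_card (R := ℝ) t
    rw [Set.finrank, h, finrank_top] at this
    lia
  obtain ⟨ω, hω, hker⟩ := Submodule.exists_le_ker_of_lt_top _ hspan
  obtain ⟨A, hAt, hfst, -⟩ := exists_linearEquiv_eq_baseVector hdim ht htS hface hω fun k =>
    hker (Submodule.subset_span ⟨k, rfl⟩)
  have hrange : A '' range t = range baseVector := by
    rw [← range_comp, show A ∘ t = baseVector from funext hAt]
  have hAS := hS.image_equiv A
  have hbase : range baseVector ⊆ A '' S := hrange ▸ image_mono htS
  have hfst' : ∀ v ∈ A '' S \ range baseVector, ∀ k, 0 < v.1 k := by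
    rw [image_sdiff_range_baseVector hAt]
    exact forall_mem_image.2 fun v hv => hfst v hv
  have hsnd := fun v hv => hAS.snd_ne_zero hbase hv (hfst' v hv)
  have hmissing' : ¬ IsConeFace (A '' S) (range baseVector) := by
    rwa [← hrange, isConeFace_image_equiv_iff]
  have hside := fun {ε : ℝ} => isOnSide_sep (ε := ε) (hAS.range_baseVector_ssubset hbase) hfst' hsnd
    hmissing'
  refine ⟨A, _, _, hAt, hside one_ne_zero, hside (neg_ne_zero.2 one_ne_zero), ?_⟩
  refine Subset.antisymm (fun v hv => ?_) (union_subset (sep_subset _ _) (sep_subset _ _))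
  by_cases hvb : v ∈ range baseVector
  · exact .inl ⟨hv, .inl hvb⟩
  · rcases (hsnd v ⟨hv, hvb⟩).lt_or_gt with h | h
    · exact .inr ⟨hv, .inr (by simpa using h)⟩
    · exact .inl ⟨hv, .inr (by simpa using h)⟩

end Coordinates

namespace SimplicialPolytope

open Set

variable {P Q R : SimplicialPolytope}

/-- The boundary complex of `R` is obtained by gluing those of `P` and `Q` along their facets `F`
and `G` and removing the common facet. The identification of `F` with `G` is encoded by the
inclusions `i` and `j` of the vertices of `P` and `Q` into those of `R`. -/
structure IsGluing (F : Set P.Vertex) (G : Set Q.Vertex) (i : P.Vertex ↪ R.Vertex)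
    (j : Q.Vertex ↪ R.Vertex) : Prop where
  isFacet_left : P.IsFacet F
  isFacet_right : Q.IsFacet G
  image_eq : i '' F = j '' G
  range_inter : range i ∩ range j = i '' F
  range_union : range i ∪ range j = univ
  isFace_iff : ∀ τ, R.IsFace τ ↔
    (∃ σ, P.IsFace σ ∧ σ ≠ F ∧ i '' σ = τ) ∨ ∃ σ, Q.IsFace σ ∧ σ ≠ G ∧ j '' σ = τ

theorem isConnectedSum_iff_exists_isGluing :
    IsConnectedSum P Q R ↔ ∃ (F : Set P.Vertex) (G : Set Q.Vertex) (i : P.Vertex ↪ R.Vertex)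
      (j : Q.Vertex ↪ R.Vertex), IsGluing F G i j :=
  exists₄_congr fun _ _ _ _ => ⟨fun ⟨hF, hG, himage, hinter, hunion, hface⟩ =>
    ⟨hF, hG, himage, hinter, hunion, hface⟩, fun ⟨hF, hG, himage, hinter, hunion, hface⟩ =>
    ⟨hF, hG, himage, hinter, hunion, hface⟩⟩

section VectorModel

variable {V : Type*} [AddCommGroup V] [Module ℝ V] {φ : P.Vertex → V} {χ : R.Vertex → V}

theorem IsVectorModel.exists_embedding (hφ : P.IsVectorModel φ) (hrange : range φ ⊆ range χ) :
    ∃ i : P.Vertex ↪ R.Vertex, ∀ u, χ (i u) = φ u := by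
  choose i hi using fun u => hrange (mem_range_self u)
  exact ⟨⟨i, fun u v huv => hφ.injective (by rw [← hi, ← hi, huv])⟩, hi⟩

theorem IsVectorModel.exists_isFace_image_eq_iff (hφ : P.IsVectorModel φ)
    (hχ : Function.Injective χ) {i : P.Vertex → R.Vertex} (hi : ∀ u, χ (i u) = φ u) {B : Set V}
    (hB : B ⊆ range φ) (τ : Set R.Vertex) :
    (∃ σ, P.IsFace σ ∧ σ ≠ φ ⁻¹' B ∧ i '' σ = τ) ↔
      IsConeFace (range φ) (χ '' τ) ∧ χ '' τ ≠ B := by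
  have himage : ∀ σ, χ '' (i '' σ) = φ '' σ := fun σ => by rw [image_image]; simp only [hi]
  have hne : ∀ σ, σ ≠ φ ⁻¹' B ↔ φ '' σ ≠ B := fun σ => by
    rw [← hφ.injective.image_injective.ne_iff, image_preimage_eq_of_subset hB]
  constructor
  · rintro ⟨σ, hσ, hσB, rfl⟩
    rw [himage]
    exact ⟨(hφ.isFace_iff σ).1 hσ, (hne σ).1 hσB⟩
  · rintro ⟨hτ, hτB⟩
    obtain ⟨σ, hσ⟩ := subset_range_iff_exists_image_eq.1 hτ.1.subset
    rw [← hσ] at hτ hτB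
    exact ⟨σ, (hφ.isFace_iff σ).2 hτ, (hne σ).2 hτB,
      hχ.image_injective ((himage σ).trans hσ)⟩

end VectorModel

section Gluing

variable {φ : P.Vertex → (Fin 3 → ℝ) × ℝ} {ψ : Q.Vertex → (Fin 3 → ℝ) × ℝ}
  {χ : R.Vertex → (Fin 3 → ℝ) × ℝ} {ε : ℝ}

theorem IsVectorModel.isFacet_preimage (hφ : P.IsVectorModel φ) (hside : IsOnSide ε (range φ)) :
    P.IsFacet (φ ⁻¹' range baseVector) := by
  have himage := image_preimage_eq_of_subset hside.base_subset
  constructor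
  · rw [hφ.isFace_iff, himage]
    exact hside.isConeFace_range_baseVector
  · rw [← ncard_image_of_injective _ hφ.injective, himage,
      ncard_range_of_injective baseVector_injective, Nat.card_fin]

theorem exists_isGluing_of_isVectorModel (hφ : P.IsVectorModel φ) (hψ : Q.IsVectorModel ψ)
    (hχ : R.IsVectorModel χ) (hφside : IsOnSide ε (range φ)) (hψside : IsOnSide (-ε) (range ψ))
    (hrange : range χ = range φ ∪ range ψ) :
    ∃ (i : P.Vertex ↪ R.Vertex) (j : Q.Vertex ↪ R.Vertex), (∀ u, χ (i u) = φ u) ∧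
      (∀ v, χ (j v) = ψ v) ∧
      IsGluing (φ ⁻¹' range baseVector) (ψ ⁻¹' range baseVector) i j := by
  obtain ⟨i, hi⟩ := hφ.exists_embedding (hrange ▸ subset_union_left)
  obtain ⟨j, hj⟩ := hψ.exists_embedding (hrange ▸ subset_union_right)
  have himage_i : χ '' (i '' (φ ⁻¹' range baseVector)) = range baseVector := by
    simp only [image_image, hi]
    exact image_preimage_eq_of_subset hφside.base_subset
  have himage_j : χ '' (j '' (ψ ⁻¹' range baseVector)) = range baseVector := by
    simp only [image_image, hj]
    exact image_preimage_eq_of_subset hψside.base_subset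
  have hrange_i : χ '' range i = range φ := by rw [← range_comp]; exact congrArg range (funext hi)
  have hrange_j : χ '' range j = range ψ := by rw [← range_comp]; exact congrArg range (funext hj)
  refine ⟨i, j, hi, hj, hφ.isFacet_preimage hφside, hψ.isFacet_preimage hψside,
    hχ.injective.image_injective (himage_i.trans himage_j.symm), hχ.injective.image_injective ?_,
    hχ.injective.image_injective ?_, fun τ => ?_⟩
  · rw [image_inter hχ.injective, hrange_i, hrange_j, himage_i, hφside.inter_eq hψside]
  · rw [image_union, hrange_i, hrange_j, image_univ, hrange]
  · rw [hχ.isFace_iff, hrange, isConeFace_union_iff hφside hψside, or_and_right,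
      hφ.exists_isFace_image_eq_iff hχ.injective hi hφside.base_subset,
      hψ.exists_isFace_image_eq_iff hχ.injective hj hψside.base_subset]

theorem exists_isVectorModel_isOnSide (a : Fin 3 ↪ P.Vertex) (ha : P.IsFace (range a))
    (hε : ε ≠ 0) : ∃ φ : P.Vertex → (Fin 3 → ℝ) × ℝ, P.IsVectorModel φ ∧
      (∀ k, φ (a k) = baseVector k) ∧ IsOnSide ε (range φ) := by
  have hφ := P.isVectorModel_homogenize
  rw [hφ.isFace_iff, ← range_comp] at ha
  obtain ⟨A, hA, hside⟩ := hφ.isSimplicialConfig.exists_isOnSide_image (by simp)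
    (hφ.injective.comp a.injective) ha hε
  exact ⟨_, hφ.comp_equiv A, hA, by rwa [range_comp]⟩

theorem preimage_range_baseVector_eq (hφ : Function.Injective φ) {a : Fin 3 → P.Vertex}
    (ha : ∀ k, φ (a k) = baseVector k) : φ ⁻¹' range baseVector = range a := by
  rw [← show φ ∘ a = baseVector from funext ha, range_comp, preimage_image_eq _ hφ]

theorem exists_isGluing (a : Fin 3 ↪ P.Vertex) (b : Fin 3 ↪ Q.Vertex) (ha : P.IsFace (range a))
    (hb : Q.IsFace (range b)) :
    ∃ (R : SimplicialPolytope) (i : P.Vertex ↪ R.Vertex) (j : Q.Vertex ↪ R.Vertex),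
      IsGluing (range a) (range b) i j ∧ ∀ k, i (a k) = j (b k) := by
  obtain ⟨φ, hφ, hφa, hφside⟩ := exists_isVectorModel_isOnSide a ha one_ne_zero
  obtain ⟨ψ, hψ, hψb, hψside⟩ := exists_isVectorModel_isOnSide b hb (neg_ne_zero.2 one_ne_zero)
  obtain ⟨R, χ, hχ, hrange⟩ := exists_isVectorModel (by simp)
    ((isSimplicialConfig_union_iff hφside hψside).2 ⟨hφ.isSimplicialConfig, hψ.isSimplicialConfig⟩)
  obtain ⟨i, j, hi, hj, hglue⟩ :=
    exists_isGluing_of_isVectorModel hφ hψ hχ hφside hψside hrange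
  rw [preimage_range_baseVector_eq hφ.injective hφa,
    preimage_range_baseVector_eq hψ.injective hψb] at hglue
  exact ⟨R, i, j, hglue, fun k => hχ.injective (by rw [hi, hj, hφa, hψb])⟩

theorem exists_isConnectedSum_of_not_isFace (t : Fin 3 ↪ R.Vertex)
    (hface : ∀ k, R.IsFace (range t \ {t k})) (hmissing : ¬ R.IsFace (range t)) :
    ∃ P Q, IsConnectedSum P Q R := by
  have hχ := R.isVectorModel_homogenize
  simp only [hχ.isFace_iff, image_sdiff hχ.injective, image_singleton, ← range_comp]
    at hface hmissing
  obtain ⟨A, U, L, -, hU, hL, hUL⟩ := hχ.isSimplicialConfig.exists_image_eq_union (by simp)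
    (hχ.injective.comp t.injective) (range_comp_subset_range _ _) hface hmissing
  have hconfig := (isSimplicialConfig_union_iff hU hL).1
    (hUL ▸ hχ.isSimplicialConfig.image_equiv A)
  obtain ⟨P, φ, hφ, rfl⟩ := exists_isVectorModel (by simp) hconfig.1
  obtain ⟨Q, ψ, hψ, rfl⟩ := exists_isVectorModel (by simp) hconfig.2
  obtain ⟨i, j, -, -, hglue⟩ := exists_isGluing_of_isVectorModel hφ hψ (hχ.comp_equiv A) hU hL
    (by rw [range_comp, hUL])
  exact ⟨P, Q, isConnectedSum_iff_exists_isGluing.2 ⟨_, _, i, j, hglue⟩⟩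

end Gluing

end SimplicialPolytope

section Permutations

open Equiv

theorem exists_perm_forall_eq_of_range_eq {ι α : Type*} {f g : ι → α} (hf : Function.Injective f)
    (hg : Function.Injective g) (h : Set.range f = Set.range g) :
    ∃ π : Perm ι, ∀ k, f k = g (π k) :=
  ⟨(ofInjective f hf).trans ((setCongr h).trans (ofInjective g hg).symm), fun k => by
    simp [apply_ofInjective_symm]⟩

theorem range_fin_three {α : Type*} (f : Fin 3 → α) : Set.range f = {f 0, f 1, f 2} := by
  ext x
  simp [Fin.exists_fin_succ, eq_comm]

theorem exists_embedding_fin_range_eq {α : Type*} {T : Set α} (hT : T.Finite) {n : ℕ}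
    (h : T.ncard = n) : ∃ t : Fin n ↪ α, Set.range t = T := by
  have : Finite T := hT
  refine ⟨(Finite.equivFinOfCardEq h).symm.toEmbedding.trans (Function.Embedding.subtype _), ?_⟩
  rw [Function.Embedding.coe_trans, coe_toEmbedding, Set.range_comp, range_eq_univ,
    Set.image_univ, Function.Embedding.coe_subtype, Subtype.range_coe]

theorem exists_perm_apply_eq_apply_eq {ι : Type*} {k l m n : ι} (hkl : k ≠ l) (hmn : m ≠ n) :
    ∃ σ : Perm ι, σ k = m ∧ σ l = n :=
  MulAction.is_two_pretransitive_iff.1 (Perm.isMultiplyPretransitive ι 2) hkl hmn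

variable {ι K : Type*} [Fintype ι] [CommRing K] [NoZeroDivisors K] {p q : ι → K}

theorem sum_mul_comp_eq_of_add_comp_eq [NeZero (2 : K)] {σ π : Perm ι}
    (h : ∀ k, p k + q (σ k) = p (π k) + q (π k)) : ∑ k, p k * q (σ k) = ∑ k, p k * q k := by
  have hsq : ∑ k, (p k + q (σ k)) ^ 2 = ∑ k, (p k + q k) ^ 2 := by
    rw [← sum_comp π fun k => (p k + q k) ^ 2]
    exact Finset.sum_congr rfl fun k _ => by rw [h]
  simp only [add_sq, Finset.sum_add_distrib, mul_assoc, ← Finset.mul_sum,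
    sum_comp σ fun k => q k ^ 2, add_left_inj, add_right_inj] at hsq
  exact mul_left_cancel₀ two_ne_zero hsq

theorem forall_eq_or_forall_eq_of_sum_mul_comp_eq {c : K}
    (h : ∀ σ : Perm ι, ∑ k, p k * q (σ k) = c) : (∀ k l, p k = p l) ∨ ∀ k l, q k = q l := by
  classical
  by_contra! hne
  obtain ⟨⟨k, l, hkl⟩, m, n, hmn⟩ := hne
  have hkl' : k ≠ l := ne_of_apply_ne p hkl
  obtain ⟨σ, rfl, rfl⟩ := exists_perm_apply_eq_apply_eq hkl' (ne_of_apply_ne q hmn)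
  have hdiff : ∑ x, p x * (q (σ x) - q (σ (swap k l x))) = 0 := by
    simp only [mul_sub, Finset.sum_sub_distrib]
    exact sub_eq_zero.2 ((h σ).trans (h ((swap k l).trans σ)).symm)
  rw [Fintype.sum_eq_add k l hkl' fun x hx => by rw [swap_apply_of_ne_of_ne hx.1 hx.2, sub_self,
    mul_zero], swap_apply_left, swap_apply_right] at hdiff
  exact mul_ne_zero (sub_ne_zero.2 hkl) (sub_ne_zero.2 hmn) (by linear_combination hdiff)

end Permutations

namespace SimplicialPolytope

open Set

variable {P Q R S : SimplicialPolytope}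

/-- A missing triangle consists of three pairwise adjacent vertices which do not form a facet. -/
def IsMissingTriangle (P : SimplicialPolytope) (T : Set P.Vertex) : Prop :=
  P.graph.IsClique T ∧ T.ncard = 3 ∧ ¬ P.IsFace T

theorem IsFacet.isClique {F : Set P.Vertex} (hF : P.IsFacet F) : P.graph.IsClique F :=
  fun _ hu _ hv huv => ⟨huv, hF.1.mono (pair_subset hu hv)⟩

theorem isClique_image_iff {f : P.Vertex → R.Vertex} (hf : Function.Injective f)
    (hadj : ∀ u v, R.graph.Adj (f u) (f v) ↔ P.graph.Adj u v) {T : Set P.Vertex} :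
    R.graph.IsClique (f '' T) ↔ P.graph.IsClique T := by
  rw [SimpleGraph.IsClique, hf.injOn.pairwise_image]
  exact forall₅_congr fun u _ v _ _ => hadj u v

theorem Irreducible.not_isMissingTriangle (hP : P.Irreducible) (T : Set P.Vertex) :
    ¬ P.IsMissingTriangle T := by
  rintro ⟨hclique, hcard, hface⟩
  obtain ⟨t, rfl⟩ := exists_embedding_fin_range_eq T.toFinite hcard
  refine hP (exists_isConnectedSum_of_not_isFace t (fun k => ?_) hface)
  have hadj := hclique (mem_range_self (k + 1)) (mem_range_self (k + 2)) (t.injective.ne (by simp))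
  refine hadj.2.mono ?_
  rintro _ ⟨⟨l, rfl⟩, hl⟩
  have hcases : ∀ k l : Fin 3, l = k ∨ l = k + 1 ∨ l = k + 2 := by decide
  rcases hcases k l with rfl | rfl | rfl
  exacts [(hl rfl).elim, .inl rfl, .inr rfl]

namespace IsGluing

variable {F : Set P.Vertex} {G : Set Q.Vertex} {i : P.Vertex ↪ R.Vertex} {j : Q.Vertex ↪ R.Vertex}

theorem symm (h : IsGluing F G i j) : IsGluing G F j i where
  isFacet_left := h.isFacet_right
  isFacet_right := h.isFacet_left
  image_eq := h.image_eq.symm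
  range_inter := by rw [inter_comm, h.range_inter, h.image_eq]
  range_union := by rw [union_comm, h.range_union]
  isFace_iff τ := (h.isFace_iff τ).trans or_comm

theorem isFace_image (h : IsGluing F G i j) {σ : Set P.Vertex} (hσ : P.IsFace σ) (hne : σ ≠ F) :
    R.IsFace (i '' σ) :=
  (h.isFace_iff _).2 (.inl ⟨σ, hσ, hne, rfl⟩)

theorem isFace_of_isFace_image (h : IsGluing F G i j) {σ : Set P.Vertex}
    (hσ : R.IsFace (i '' σ)) : P.IsFace σ := by
  rcases (h.isFace_iff _).1 hσ with ⟨σ', hσ', -, heq⟩ | ⟨σ', -, -, heq⟩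
  · rwa [← i.injective.image_injective heq]
  · refine h.isFacet_left.1.mono ((image_subset_image_iff i.injective).1 ?_)
    rw [← h.range_inter]
    exact subset_inter (image_subset_range i σ) (heq ▸ image_subset_range j σ')

theorem adj_iff (h : IsGluing F G i j) (u v : P.Vertex) :
    R.graph.Adj (i u) (i v) ↔ P.graph.Adj u v := by
  refine and_congr i.injective.ne_iff ?_
  rw [← image_pair]
  refine ⟨h.isFace_of_isFace_image, fun huv => h.isFace_image huv fun hF => ?_⟩
  have hle := ncard_insert_le u {v}
  rw [hF, h.isFacet_left.2, ncard_singleton] at hle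
  lia

theorem subset_range_or_subset_range (h : IsGluing F G i j) {τ : Set R.Vertex} (hτ : R.IsFace τ) :
    τ ⊆ range i ∨ τ ⊆ range j := by
  rcases (h.isFace_iff τ).1 hτ with ⟨σ, -, -, rfl⟩ | ⟨σ, -, -, rfl⟩
  exacts [.inl (image_subset_range i σ), .inr (image_subset_range j σ)]

theorem isMissingTriangle_image (h : IsGluing F G i j) : R.IsMissingTriangle (i '' F) := by
  refine ⟨(isClique_image_iff i.injective h.adj_iff).2 h.isFacet_left.isClique,
    (ncard_image_of_injective F i.injective).trans h.isFacet_left.2, fun hface => ?_⟩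
  rcases (h.isFace_iff _).1 hface with ⟨σ, -, hne, hσ⟩ | ⟨σ, -, hne, hσ⟩
  · exact hne (i.injective.image_injective hσ)
  · exact hne (j.injective.image_injective (hσ.trans h.image_eq))

theorem eq_image_of_isMissingTriangle_of_subset (h : IsGluing F G i j) (hP : P.Irreducible)
    {T : Set R.Vertex} (hT : R.IsMissingTriangle T) (hsub : T ⊆ range i) : T = i '' F := by
  obtain ⟨σ, rfl⟩ := subset_range_iff_exists_image_eq.1 hsub
  obtain ⟨hclique, hcard, hface⟩ := hT
  by_contra hne
  exact hP.not_isMissingTriangle σ ⟨(isClique_image_iff i.injective h.adj_iff).1 hclique,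
    (ncard_image_of_injective σ i.injective).symm.trans hcard,
    fun hσ => hface (h.isFace_image hσ fun heq => hne (heq ▸ rfl))⟩

theorem eq_image_of_isMissingTriangle (h : IsGluing F G i j) (hP : P.Irreducible)
    (hQ : Q.Irreducible) {T : Set R.Vertex} (hT : R.IsMissingTriangle T) : T = i '' F := by
  by_cases hi : T ⊆ range i
  · exact h.eq_image_of_isMissingTriangle_of_subset hP hT hi
  by_cases hj : T ⊆ range j
  · exact h.image_eq ▸ h.symm.eq_image_of_isMissingTriangle_of_subset hQ hT hj
  obtain ⟨x, hx, hxi⟩ := not_subset.1 hi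
  obtain ⟨y, hy, hyj⟩ := not_subset.1 hj
  have hyi : y ∈ range i := (h.range_union.ge (mem_univ y)).resolve_right hyj
  have hxy := hT.1 hx hy fun heq => hxi (heq ▸ hyi)
  rcases h.subset_range_or_subset_range hxy.2 with hsub | hsub
  exacts [(hxi (hsub (.inl rfl))).elim, (hyj (hsub (.inr rfl))).elim]

theorem image_neighborSet (h : IsGluing F G i j) (u : P.Vertex) :
    i '' P.graph.neighborSet u = R.graph.neighborSet (i u) ∩ range i := by
  rw [← image_preimage_eq_inter_range]
  congr 1
  ext v
  exact (h.adj_iff u v).symm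

theorem neighborSet_inter_range_inter_range (h : IsGluing F G i j) {u : P.Vertex} (hu : u ∈ F) :
    R.graph.neighborSet (i u) ∩ (range i ∩ range j) = i '' (F \ {u}) := by
  have hF : P.graph.neighborSet u ∩ F = F \ {u} := by
    ext v
    exact ⟨fun hv => ⟨hv.2, fun heq => hv.1.1 heq.symm⟩, fun hv =>
      ⟨h.isFacet_left.isClique hu hv.1 (Ne.symm hv.2), hv.1⟩⟩
  rw [h.range_inter, ← hF, image_inter i.injective, h.image_neighborSet, inter_assoc,
    inter_eq_right.2 (image_subset_range i F)]

theorem degree_add_two (h : IsGluing F G i j) {u : P.Vertex} {v : Q.Vertex} (hu : u ∈ F)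
    (huv : i u = j v) : R.degree (i u) + 2 = P.degree u + Q.degree v := by
  have hcard := ncard_union_add_ncard_inter (R.graph.neighborSet (i u) ∩ range i)
    (R.graph.neighborSet (i u) ∩ range j)
  rw [← inter_union_distrib_left, ← inter_inter_distrib_left, h.range_union, inter_univ,
    h.neighborSet_inter_range_inter_range hu, ncard_image_of_injective _ i.injective,
    ncard_sdiff_singleton_of_mem hu, h.isFacet_left.2, ← h.image_neighborSet, huv,
    ← h.symm.image_neighborSet, ncard_image_of_injective _ i.injective,
    ncard_image_of_injective _ j.injective] at hcard
  rwa [huv]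

end IsGluing

section Isomorphism

variable {e : R.Vertex ≃ S.Vertex}

theorem adj_apply_iff (he : ∀ σ, R.IsFace σ ↔ S.IsFace (e '' σ)) (u v : R.Vertex) :
    S.graph.Adj (e u) (e v) ↔ R.graph.Adj u v := by
  refine and_congr e.injective.ne_iff ?_
  rw [he, image_pair]

theorem IsMissingTriangle.image (he : ∀ σ, R.IsFace σ ↔ S.IsFace (e '' σ)) {T : Set R.Vertex}
    (hT : R.IsMissingTriangle T) : S.IsMissingTriangle (e '' T) :=
  ⟨(isClique_image_iff e.injective (adj_apply_iff he)).2 hT.1,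
    (ncard_image_of_injective T e.injective).trans hT.2.1, (he T).not.1 hT.2.2⟩

theorem degree_apply (he : ∀ σ, R.IsFace σ ↔ S.IsFace (e '' σ)) (u : R.Vertex) :
    S.degree (e u) = R.degree u := by
  have himage : e '' R.graph.neighborSet u = S.graph.neighborSet (e u) := by
    rw [← e.image_preimage (S.graph.neighborSet (e u))]
    congr 1
    ext v
    exact (adj_apply_iff he u v).symm
  rw [degree, ← himage, ncard_image_of_injective _ e.injective, degree]

theorem isomorphic_of_ncard_connectedSums_eq_one (h : (connectedSums P Q).ncard = 1)
    (hR : IsConnectedSum P Q R) (hS : IsConnectedSum P Q S) : Isomorphic R S := by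
  obtain ⟨c, hc⟩ := ncard_eq_one.1 h
  have heq : ∀ R', IsConnectedSum P Q R' → Quotient.mk isoSetoid R' = c := fun R' hR' =>
    hc.le ⟨R', hR', rfl⟩
  exact Quotient.exact ((heq R hR).trans (heq S hS).symm)

end Isomorphism

/-- Up to a permutation, the sums of the degrees of corresponding vertices of a facet of `P` and a
facet of `Q` do not depend on the facets and on the correspondence. Facets are given by enumerations
of their vertices, and vertices with equal indices correspond. -/
def HasUniformDegreeSums (P Q : SimplicialPolytope) : Prop :=
  ∀ (a a' : Fin 3 ↪ P.Vertex) (b b' : Fin 3 ↪ Q.Vertex), P.IsFace (range a) →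
    P.IsFace (range a') → Q.IsFace (range b) → Q.IsFace (range b') → ∃ π : Equiv.Perm (Fin 3), ∀ k,
      P.degree (a k) + Q.degree (b k) = P.degree (a' (π k)) + Q.degree (b' (π k))

/-- The three vertices of each facet of `P` have the same degree, which may depend on the facet. -/
def HasEquidegreeFacets (P : SimplicialPolytope) : Prop :=
  ∀ a : Fin 3 ↪ P.Vertex, P.IsFace (range a) → ∀ k l, P.degree (a k) = P.degree (a l)

theorem hasUniformDegreeSums (hP : P.Irreducible) (hQ : Q.Irreducible)
    (h : (connectedSums P Q).ncard = 1) : HasUniformDegreeSums P Q := by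
  intro a a' b b' ha ha' hb hb'
  obtain ⟨R, i, j, hR, hij⟩ := exists_isGluing a b ha hb
  obtain ⟨S, i', j', hS, hij'⟩ := exists_isGluing a' b' ha' hb'
  obtain ⟨e, he⟩ := isomorphic_of_ncard_connectedSums_eq_one h
    (isConnectedSum_iff_exists_isGluing.2 ⟨_, _, i, j, hR⟩)
    (isConnectedSum_iff_exists_isGluing.2 ⟨_, _, i', j', hS⟩)
  have htriangle : range (e ∘ i ∘ a) = range (i' ∘ a') := by
    rw [range_comp, range_comp, range_comp]
    exact hS.eq_image_of_isMissingTriangle hP hQ (hR.isMissingTriangle_image.image he)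
  obtain ⟨π, hπ⟩ := exists_perm_forall_eq_of_range_eq
    (e.injective.comp (i.injective.comp a.injective)) (i'.injective.comp a'.injective) htriangle
  refine ⟨π, fun k => ?_⟩
  rw [← hR.degree_add_two (mem_range_self k) (hij k), ← degree_apply he,
    ← hS.degree_add_two (mem_range_self (π k)) (hij' (π k))]
  exact congrArg (fun x => S.degree x + 2) (hπ k)

theorem hasType_of_exists_perm {d : Fin 3 → ℕ} (hd : Antitone d)
    (h : ∀ a : Fin 3 ↪ P.Vertex, P.IsFace (range a) → ∃ π : Equiv.Perm (Fin 3), ∀ k,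
      d k = P.degree (a (π k))) : P.HasType (d 0) (d 1) (d 2) := by
  intro F hF
  obtain ⟨a, rfl⟩ := exists_embedding_fin_range_eq F.toFinite hF.2
  obtain ⟨π, hπ⟩ := h a hF.1
  have hinj := a.injective.comp π.injective
  exact ⟨hd (by decide), hd (by decide), a (π 0), a (π 1), a (π 2), hinj.ne (by decide),
    hinj.ne (by decide), hinj.ne (by decide), (π.surjective.range_comp a).symm.trans
    (range_fin_three _), (hπ 0).symm, (hπ 1).symm, (hπ 2).symm⟩

namespace HasUniformDegreeSums

variable {F : Set P.Vertex} {G : Set Q.Vertex}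

theorem symm (h : HasUniformDegreeSums P Q) : HasUniformDegreeSums Q P := by
  intro b b' a a' hb hb' ha ha'
  obtain ⟨π, hπ⟩ := h a a' b b' ha ha' hb hb'
  exact ⟨π, fun k => by rw [add_comm, hπ, add_comm]⟩

theorem hasEquidegreeFacets_or (h : HasUniformDegreeSums P Q) :
    P.HasEquidegreeFacets ∨ Q.HasEquidegreeFacets := by
  by_contra! hne
  simp only [HasEquidegreeFacets, not_forall] at hne
  obtain ⟨⟨a, ha, k, l, hkl⟩, b, hb, m, n, hmn⟩ := hne
  have hsum : ∀ σ : Equiv.Perm (Fin 3), ∑ k, (P.degree (a k) : ℤ) * Q.degree (b (σ k)) =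
      ∑ k, (P.degree (a k) : ℤ) * Q.degree (b k) := fun σ => by
    obtain ⟨π, hπ⟩ := h a a (σ.toEmbedding.trans b) b ha ha
      (by rwa [Function.Embedding.coe_trans, Equiv.coe_toEmbedding, σ.surjective.range_comp]) hb
    exact sum_mul_comp_eq_of_add_comp_eq (p := fun k => (P.degree (a k) : ℤ))
      (q := fun k => (Q.degree (b k) : ℤ)) fun k => mod_cast hπ k
  rcases forall_eq_or_forall_eq_of_sum_mul_comp_eq (p := fun k => (P.degree (a k) : ℤ))
    (q := fun k => (Q.degree (b k) : ℤ)) hsum with hp | hq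
  exacts [hkl (mod_cast hp k l), hmn (mod_cast hq m n)]

theorem regular (h : HasUniformDegreeSums P Q) (hF : P.IsFacet F) (hG : Q.IsFacet G)
    (hP : P.HasEquidegreeFacets) : P.Regular := by
  obtain ⟨a₀, rfl⟩ := exists_embedding_fin_range_eq F.toFinite hF.2
  obtain ⟨b, rfl⟩ := exists_embedding_fin_range_eq G.toFinite hG.2
  refine ⟨P.degree (a₀ 0), hasType_of_exists_perm (d := fun _ => P.degree (a₀ 0)) antitone_const
    fun a ha => ⟨1, fun k => ?_⟩⟩
  obtain ⟨π, hπ⟩ := h a₀ a b b hF.1 ha hG.1 hG.1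
  have hsum : ∑ k, (P.degree (a₀ k) + Q.degree (b k)) = ∑ k, (P.degree (a k) + Q.degree (b k)) := by
    rw [← Equiv.sum_comp π fun k => P.degree (a k) + Q.degree (b k)]
    exact Finset.sum_congr rfl fun k _ => hπ k
  simpa [Finset.sum_add_distrib, hP a₀ hF.1 _ 0, hP a ha _ k] using hsum

theorem faceTransitive (h : HasUniformDegreeSums P Q) (hF : P.IsFacet F) (hG : Q.IsFacet G)
    (hP : P.HasEquidegreeFacets) : Q.FaceTransitive := by
  obtain ⟨a, rfl⟩ := exists_embedding_fin_range_eq F.toFinite hF.2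
  obtain ⟨b₀, rfl⟩ := exists_embedding_fin_range_eq G.toFinite hG.2
  let σ := Tuple.sort fun k => OrderDual.toDual (Q.degree (b₀ k))
  have hσ : Antitone fun k => Q.degree (b₀ (σ k)) := fun k l hkl =>
    Tuple.monotone_sort (fun k => OrderDual.toDual (Q.degree (b₀ k))) hkl
  refine ⟨_, _, _, hasType_of_exists_perm hσ fun b hb => ?_⟩
  obtain ⟨π, hπ⟩ := h a a b₀ b hF.1 hF.1 hG.1 hb
  exact ⟨σ.trans π, fun k => Nat.add_left_cancel ((hπ (σ k)).trans (by
    rw [hP a hF.1 (π (σ k)) (σ k), Equiv.trans_apply]))⟩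

end HasUniformDegreeSums

end SimplicialPolytope

theorem mainTheorem8 (P Q : SimplicialPolytope) (hP : P.Irreducible) (hQ : Q.Irreducible)
    (h : (SimplicialPolytope.connectedSums P Q).ncard = 1) :
    (P.Regular ∧ Q.FaceTransitive) ∨ (Q.Regular ∧ P.FaceTransitive) := by
  obtain ⟨c, hc⟩ := Set.ncard_eq_one.1 h
  obtain ⟨R, ⟨F, G, -, -, hF, hG, -⟩, -⟩ := hc.ge rfl
  have hsums := SimplicialPolytope.hasUniformDegreeSums hP hQ h
  rcases hsums.hasEquidegreeFacets_or with hfacets | hfacets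
  · exact .inl ⟨hsums.regular hF hG hfacets, hsums.faceTransitive hF hG hfacets⟩
  · exact .inr ⟨hsums.symm.regular hG hF hfacets, hsums.symm.faceTransitive hG hF hfacets⟩
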